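/- Let $\mathbb K$ be an algebraically closed field of characteristic zero, let $m\ge 1$, $p\ge 1$, $q\ge 0$ be integers, and let $a_1,\dots,a_m$, $b_1,\dots,b_p$, $c_1,\dots,c_q$ be integers, all $\ge 2$. Suppose that it is not the case that all $b_j$ and all $c_k$ are even with some $b_j=2$ and some $c_k=2$ (for $q=0$ this is no restriction). Let $$X=\{x\,y_1^{a_1}\cdots y_m^{a_m}+z_1^{b_1}\cdots z_p^{b_p}+s_1^{c_1}\cdots s_q^{c_q}=0\}\subset\mathbb K^{1+m+p+q},$$ where for $q=0$ the last monomial is $1$. Let $\mathrm{SAut}(X)$ be the group generated by all $\mathbb G_a$-subgroups of $\mathrm{Aut}(X)$, i.e. by the images of all regular actions of $(\mathbb K,+)$ on $X$. Then the $\mathrm{SAut}(X)$-orbits on $X$ are exactly the following sets. 1. The sets $\mathcal S(d_1,\dots,d_m)=\{\alpha\in X\mid y_i(\alpha)=d_i \text{ for all } i\}$ with all $d_i\in\mathbb K$ nonzero. Each of them is isomorphic, as an algebraic variety, to $\mathbb K^{p+q}$. 2. The sets $\mathcal L(d,r,t)=\{\alpha\in X\mid y_i(\alpha)=d_i,\ z_j(\alpha)=r_j,\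 s_k(\alpha)=t_k \text{ for all } i,j,k\}$, where $d\in\mathbb K^m$, $r\in\mathbb K^p$, $t\in\mathbb K^q$ are such that $d_l=0$ for some $l$, all $r_j$ and all $t_k$ are nonzero, and $r_1^{b_1}\cdots r_p^{b_p}=-t_1^{c_1}\cdots t_q^{c_q}$ (for $q=0$ the right-hand side is $-1$). Each of them is isomorphic, as an algebraic variety, to the line $\mathbb K$. 3. The one-point sets $\{\alpha\}$, where $\alpha$ is a singular point of $X$. That is, every singular point of $X$ is fixed by $\mathrm{SAut}(X)$. -/

import Mathlib

open MvPolynomial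

namespace TrinomialOrbits

section AffineVarieties

variable {K : Type*} [Field K] {σ τ : Type*}

/-- A map between subsets `V ⊆ K^σ` and `W ⊆ K^τ` is regular if its components are
restrictions of polynomials. -/
def IsRegularMap {V : Set (σ → K)} {W : Set (τ → K)} (f : V → W) : Prop :=
  ∃ P : τ → MvPolynomial σ K, ∀ (v : V) (i : τ), (f v : τ → K) i = eval (v : σ → K) (P i)

/-- Isomorphism of (closed) subvarieties of affine spaces. -/
def AreIsomorphic (V : Set (σ → K)) (W : Set (τ → K)) : Prop :=
  ∃ e : V ≃ W, IsRegularMap e ∧ IsRegularMap e.symm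

/-- A regular action of the additive group `(K, +)` on `V`: an action for which
`K × V → V`, `(t, v) ↦ t • v`, is given by polynomials in `t` and in the coordinates of `v`.
The variable `none` stands for `t`, the variables `some i` for the coordinates of `v`. -/
def IsRegularGaAction (V : Set (σ → K)) (ρ : Multiplicative K →* Equiv.Perm V) : Prop :=
  ∃ P : σ → MvPolynomial (Option σ) K, ∀ (t : K) (v : V) (i : σ),
    (ρ (Multiplicative.ofAdd t) v : σ → K) i =
      eval (fun o : Option σ => o.elim t (v : σ → K)) (P i)

/-- A `𝔾ₐ`-subgroup of the automorphism group of `V`: the image of `(K, +)` under a regular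
action. (The trivial action is allowed; it contributes the trivial subgroup only.) -/
def IsGaSubgroup (V : Set (σ → K)) (H : Subgroup (Equiv.Perm V)) : Prop :=
  ∃ ρ : Multiplicative K →* Equiv.Perm V, IsRegularGaAction V ρ ∧ H = ρ.range

/-- The group `SAut(V)` of special automorphisms: the group of transformations of `V` generated
by all `𝔾ₐ`-subgroups. -/
def SAut (V : Set (σ → K)) : Subgroup (Equiv.Perm V) :=
  sSup {H | IsGaSubgroup V H}

/-- The set of all `SAut(V)`-orbits on `V`, as subsets of the ambient affine space. -/
def sautOrbits (V : Set (σ → K)) : Set (Set (σ → K)) :=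
  {O | ∃ α : V, O = Subtype.val '' MulAction.orbit (SAut V) α}

/-- The Zariski tangent space of `V ⊆ K^σ` at the point `α`, cut out by the differentials at `α`
of all polynomials vanishing on `V`. -/
def tangentSpace [Fintype σ] (V : Set (σ → K)) (α : σ → K) : Submodule K (σ → K) where
  carrier := {v | ∀ f ∈ vanishingIdeal K V, ∑ i, eval α (pderiv i f) * v i = 0}
  add_mem' := by
    intro v w hv hw f hf
    simp only [Pi.add_apply, mul_add, Finset.sum_add_distrib, hv f hf, hw f hf, add_zero]
  zero_mem' := by
    intro f _
    simp
  smul_mem' := by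
    intro c v hv f hf
    have h : ∑ i, eval α (pderiv i f) * (c • v) i
        = c * ∑ i, eval α (pderiv i f) * v i := by
      rw [Finset.mul_sum]
      refine Finset.sum_congr rfl fun i _ => ?_
      simp only [Pi.smul_apply, smul_eq_mul]
      ring
    rw [h, hv f hf, mul_zero]

/-- A singular point of an irreducible affine variety `V`: a point of `V` where the dimension of
the Zariski tangent space exceeds the dimension of `V`, which is the Krull dimension of the
algebra of regular functions on `V`. -/
def IsSingularPoint [Fintype σ] (V : Set (σ → K)) (α : σ → K) : Prop :=
  α ∈ V ∧ ringKrullDim (MvPolynomial σ K ⧸ vanishingIdeal K V)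
    < (Module.finrank K (tangentSpace V α) : WithBot ℕ∞)

end AffineVarieties

section Trinomial

/-- Index set of the coordinates `x`, `y₁, …, y_m`, `z₁, …, z_p`, `s₁, …, s_q`. -/
abbrev Coord (m p q : ℕ) : Type := Unit ⊕ Fin m ⊕ Fin p ⊕ Fin q

variable {K : Type*} [Field K] {m p q : ℕ}

abbrev xIdx : Coord m p q := Sum.inl ()
abbrev yIdx (i : Fin m) : Coord m p q := Sum.inr (Sum.inl i)
abbrev zIdx (j : Fin p) : Coord m p q := Sum.inr (Sum.inr (Sum.inl j))
abbrev sIdx (k : Fin q) : Coord m p q := Sum.inr (Sum.inr (Sum.inr k))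

/-- The trinomial `x y₁^{a₁} ⋯ y_m^{a_m} + z₁^{b₁} ⋯ z_p^{b_p} + s₁^{c₁} ⋯ s_q^{c_q}`
(for `q = 0` the last monomial is `1`). -/
noncomputable def trinomial (K : Type*) [Field K] {m p q : ℕ}
    (a : Fin m → ℕ) (b : Fin p → ℕ) (c : Fin q → ℕ) : MvPolynomial (Coord m p q) K :=
  X xIdx * ∏ i, X (yIdx i) ^ a i + ∏ j, X (zIdx j) ^ b j + ∏ k, X (sIdx k) ^ c k

/-- The hypersurface `X` in `K^{1+m+p+q}` where the trinomial vanishes. -/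
def hypersurface (K : Type*) [Field K] {m p q : ℕ}
    (a : Fin m → ℕ) (b : Fin p → ℕ) (c : Fin q → ℕ) : Set (Coord m p q → K) :=
  {α | eval α (trinomial K a b c) = 0}

/-- The set `𝒮(d)` of points of `X` with prescribed coordinates `y = d`. -/
def fibreS (a : Fin m → ℕ) (b : Fin p → ℕ) (c : Fin q → ℕ) (d : Fin m → K) :
    Set (Coord m p q → K) :=
  {α ∈ hypersurface K a b c | ∀ i, α (yIdx i) = d i}

/-- The set `ℒ(d, r, t)` of points of `X` with prescribed coordinates `y = d`, `z = r`,
`s = t`. -/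
def fibreL (a : Fin m → ℕ) (b : Fin p → ℕ) (c : Fin q → ℕ)
    (d : Fin m → K) (r : Fin p → K) (t : Fin q → K) : Set (Coord m p q → K) :=
  {α ∈ hypersurface K a b c |
    (∀ i, α (yIdx i) = d i) ∧ (∀ j, α (zIdx j) = r j) ∧ ∀ k, α (sIdx k) = t k}

/-- Admissible parameters of the sets `ℒ(d, r, t)`. -/
def IsLineParam (b : Fin p → ℕ) (c : Fin q → ℕ)
    (d : Fin m → K) (r : Fin p → K) (t : Fin q → K) : Prop :=
  (∃ l, d l = 0) ∧ (∀ j, r j ≠ 0) ∧ (∀ k, t k ≠ 0) ∧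
    ∏ j, r j ^ b j = -∏ k, t k ^ c k

end Trinomial

end TrinomialOrbits

/-! Write Y, Z, S for the monomials in y, z, s, so that X is xY + Z + S = 0.

There are enough automorphisms. Moving (z, s) by tY·e for a fixed vector e and correcting x by a
divided difference of Z + S is a regular action (`shiftFun`). These actions connect any two points
with the same y when Y ≠ 0. Where Y = 0 they move x alone, at a speed equal up to sign to a
directional derivative of Z + S, and this is nonzero in a z-direction if no z_j vanishes.

There are not too many. A regular action is the flow of a locally nilpotent derivation D of the
coordinate ring, which is a domain. The core is rigidity (`eq_zero_of_apply_xIdx`): if D x = 0 then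
D = 0. Granting it, give y_l weight -1 and x weight a_l. The component of D of highest degree is
again locally nilpotent. If that degree exceeded -a_l, it would send x to an element of positive
degree, hence to a multiple of x; then it would kill x and vanish. So D lowers the weight by at
least a_l, for every l. Hence D y_l is a multiple of y_l, which forces D y_l = 0, and D z_j, D s_k
are multiples of Y. Over Y = 0 the coordinates z, s are therefore constant along orbits. Cancelling
Y in the differentiated relation shows that D x vanishes where Y = 0 and some z_j and some s_k
vanish; by the Jacobian criterion these are the singular points.

Rigidity rests on the degree function of D. Exponents ≥ 2 make the monomials powerful, and a
Mason–Stothers inequality (`IsLocallyNilpotent.apply_eq_zero_of_add`) shows that D = 0 as soon as D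
kills x and one of xY, Z, S. For a fine grading, a homogeneous element is a monomial times a binary
form in U and V, where U^g = Z, V^g = S and g is the gcd of all b_j, c_k. A nonconstant form in the
kernel would put a linear factor into the kernel, which
`IsLocallyNilpotent.apply_eq_zero_of_linearForm` forbids; the excluded parity case is exactly what
is needed there for g = 2. So homogeneous kernel elements are monomials, and
`eq_zero_of_homogeneous` gets a contradiction by comparing z_j^{b_j} with s_k^{c_k}. Passing to the
highest component reduces rigidity to homogeneous D. -/

namespace TrinomialOrbits

/-! ### Locally nilpotent derivations: degree function and Mason–Stothers inequalities -/

section LocallyNilpotent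

variable {K A : Type*} [Field K] [CommRing A] [Algebra K A]

/-- A derivation is locally nilpotent if every element is annihilated by some iterate. -/
def IsLocallyNilpotent (D : Derivation K A A) : Prop := ∀ f, ∃ n, D^[n] f = 0

/-- The degree function of a locally nilpotent derivation. -/
noncomputable def nilDegree (D : Derivation K A A) (f : A) : ℕ := sInf {n | D^[n + 1] f = 0}

variable {D : Derivation K A A}

theorem iterate_eq_zero_of_le {f : A} {m n : ℕ} (h : D^[m] f = 0) (hmn : m ≤ n) :
    D^[n] f = 0 := by
  obtain ⟨k, rfl⟩ := Nat.exists_eq_add_of_le hmn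
  rw [add_comm, Function.iterate_add_apply, h, iterate_map_zero]

theorem IsLocallyNilpotent.iterate_nilDegree_succ (hD : IsLocallyNilpotent D) (f : A) :
    D^[nilDegree D f + 1] f = 0 := by
  obtain ⟨n, hn⟩ := hD f
  exact Nat.sInf_mem (s := {n | D^[n + 1] f = 0}) ⟨n, iterate_eq_zero_of_le hn n.le_succ⟩

theorem iterate_nilDegree_ne_zero {f : A} (hf : f ≠ 0) : D^[nilDegree D f] f ≠ 0 := by
  rcases h : nilDegree D f with _ | k
  · simpa using hf
  · exact Nat.notMem_of_lt_sInf (s := {n | D^[n + 1] f = 0}) (m := k)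
      (by change k < nilDegree D f; omega)

theorem IsLocallyNilpotent.nilDegree_eq (hD : IsLocallyNilpotent D) {f : A} {n : ℕ}
    (h₁ : D^[n] f ≠ 0) (h₂ : D^[n + 1] f = 0) : nilDegree D f = n := by
  have hf : f ≠ 0 := by
    rintro rfl
    exact h₁ (iterate_map_zero D n)
  apply le_antisymm
  · exact Nat.sInf_le h₂
  · by_contra! h
    exact h₁ (iterate_eq_zero_of_le (hD.iterate_nilDegree_succ f) h)

theorem nilDegree_eq_zero_of_apply_eq_zero {f : A} (h : D f = 0) : nilDegree D f = 0 :=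
  Nat.le_zero.1 (Nat.sInf_le h)

theorem IsLocallyNilpotent.apply_eq_zero (hD : IsLocallyNilpotent D) {f : A}
    (h : nilDegree D f = 0) : D f = 0 := by
  simpa [h] using hD.iterate_nilDegree_succ f

theorem IsLocallyNilpotent.nilDegree_apply (hD : IsLocallyNilpotent D) {f : A} (h : D f ≠ 0) :
    nilDegree D (D f) + 1 = nilDegree D f := by
  symm
  apply hD.nilDegree_eq
  · rw [Function.iterate_succ_apply]
    exact iterate_nilDegree_ne_zero h
  · rw [Function.iterate_succ_apply]
    exact hD.iterate_nilDegree_succ _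

/-- In the Leibniz expansion of the (m+n)-th iterate every other term contains too high an iterate
of f or of g. The constant is a binomial coefficient, built up by Pascal's rule; only its positivity
is needed. -/
theorem exists_iterate_mul (s : ℕ) : ∀ (m n : ℕ) (f g : A), m + n = s → D^[m + 1] f = 0 →
    D^[n + 1] g = 0 → ∃ c : ℕ, 0 < c ∧ D^[s] (f * g) = c * (D^[m] f * D^[n] g) := by
  induction s with
  | zero =>
    intro m n f g hs hf hg
    obtain ⟨rfl, rfl⟩ : m = 0 ∧ n = 0 := by omega
    exact ⟨1, one_pos, by simp⟩
  | succ s ih =>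
    intro m n f g hs hf hg
    have key : D^[s + 1] (f * g) = D^[s] (f * D g) + D^[s] (D f * g) := by
      rw [Function.iterate_succ_apply, D.leibniz, iterate_map_add, smul_eq_mul, smul_eq_mul,
        mul_comm g]
    rcases m with _ | m
    · obtain ⟨n, rfl⟩ : ∃ k, n = k + 1 := ⟨s, by omega⟩
      obtain ⟨c, hc, h⟩ := ih 0 n f (D g) (by omega) hf hg
      have hf' : D f = 0 := by simpa using hf
      exact ⟨c, hc, by rw [key, h, hf', zero_mul, iterate_map_zero, add_zero]; simp⟩
    · obtain ⟨c, hc, h⟩ := ih m n (D f) g (by omega) hf hg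
      rcases n with _ | n
      · have hg' : D g = 0 := by simpa using hg
        exact ⟨c, hc, by rw [key, h, hg', mul_zero, iterate_map_zero, zero_add]; simp⟩
      · obtain ⟨c', hc', h'⟩ := ih (m + 1) n f (D g) (by omega) hf hg
        refine ⟨c' + c, by omega, ?_⟩
        rw [key, h, h']
        push_cast [Function.iterate_succ_apply]
        ring

variable [IsDomain A] [CharZero A]

/-- The top iterates multiply to something nonzero in a domain of characteristic zero. Zero has to
be excluded because its degree is 0 here, not minus infinity. -/
theorem IsLocallyNilpotent.nilDegree_mul (hD : IsLocallyNilpotent D) {f g : A} (hf : f ≠ 0)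
    (hg : g ≠ 0) : nilDegree D (f * g) = nilDegree D f + nilDegree D g := by
  obtain ⟨c, hc, h⟩ := exists_iterate_mul _ _ _ f g rfl (hD.iterate_nilDegree_succ f)
    (hD.iterate_nilDegree_succ g)
  apply hD.nilDegree_eq
  · rw [h]
    exact mul_ne_zero (by exact_mod_cast hc.ne')
      (mul_ne_zero (iterate_nilDegree_ne_zero hf) (iterate_nilDegree_ne_zero hg))
  · rw [Function.iterate_succ_apply', h, D.leibniz, D.leibniz, ← Function.iterate_succ_apply' D,
      ← Function.iterate_succ_apply' D, hD.iterate_nilDegree_succ, hD.iterate_nilDegree_succ]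
    simp

theorem IsLocallyNilpotent.nilDegree_le_of_dvd (hD : IsLocallyNilpotent D) {f g : A}
    (h : f ∣ g) (hg : g ≠ 0) : nilDegree D f ≤ nilDegree D g := by
  obtain ⟨k, rfl⟩ := h
  rw [hD.nilDegree_mul (left_ne_zero_of_mul hg) (right_ne_zero_of_mul hg)]
  omega

/-- The kernel is factorially closed: degrees add up, so a factor of an element of degree 0 has
degree 0. -/
theorem IsLocallyNilpotent.apply_eq_zero_of_dvd (hD : IsLocallyNilpotent D) {f g : A}
    (h : f ∣ g) (hg : g ≠ 0) (hDg : D g = 0) : D f = 0 := by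
  apply hD.apply_eq_zero
  have := hD.nilDegree_le_of_dvd h hg
  rw [nilDegree_eq_zero_of_apply_eq_zero hDg] at this
  omega

/-- A nonzero D f has degree one less than f, so it is too small to be a multiple of f. -/
theorem IsLocallyNilpotent.apply_eq_zero_of_dvd_apply (hD : IsLocallyNilpotent D) {f : A}
    (h : f ∣ D f) : D f = 0 := by
  by_contra h0
  have h1 := hD.nilDegree_le_of_dvd h h0
  have h2 := hD.nilDegree_apply h0
  omega

theorem IsLocallyNilpotent.nilDegree_pow (hD : IsLocallyNilpotent D) {f : A} (hf : f ≠ 0)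
    (n : ℕ) : nilDegree D (f ^ n) = n * nilDegree D f := by
  induction n with
  | zero =>
    rw [pow_zero, zero_mul]
    exact nilDegree_eq_zero_of_apply_eq_zero D.map_one_eq_zero
  | succ n ih => rw [pow_succ, hD.nilDegree_mul (pow_ne_zero n hf) hf, ih]; ring

/-- `T` and its derivative have a common divisor whose degree is at least half the degree
of `T`. -/
def IsPowerful (D : Derivation K A A) (T : A) : Prop :=
  ∃ R, R ∣ T ∧ R ∣ D T ∧ nilDegree D T ≤ 2 * nilDegree D R

omit [IsDomain A] [CharZero A] in
theorem isPowerful_of_apply_eq_zero {f : A} (h : D f = 0) : IsPowerful D f :=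
  ⟨1, one_dvd _, one_dvd _, by rw [nilDegree_eq_zero_of_apply_eq_zero h]; omega⟩

theorem IsLocallyNilpotent.isPowerful_mul (hD : IsLocallyNilpotent D) {f g : A}
    (hf : IsPowerful D f) (hg : IsPowerful D g) : IsPowerful D (f * g) := by
  by_cases h0 : f * g = 0
  · exact isPowerful_of_apply_eq_zero (by rw [h0, map_zero])
  obtain ⟨R, ⟨k, rfl⟩, hR', hR⟩ := hf
  obtain ⟨S, ⟨l, rfl⟩, hS', hS⟩ := hg
  have hf0 := left_ne_zero_of_mul h0
  have hg0 := right_ne_zero_of_mul h0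
  refine ⟨R * S, ⟨k * l, by ring⟩, ?_, ?_⟩
  · rw [D.leibniz]
    exact dvd_add (mul_dvd_mul ⟨k, rfl⟩ hS') (mul_comm R S ▸ mul_dvd_mul ⟨l, rfl⟩ hR')
  · rw [hD.nilDegree_mul hf0 hg0,
      hD.nilDegree_mul (left_ne_zero_of_mul hf0) (left_ne_zero_of_mul hg0)]
    omega

theorem IsLocallyNilpotent.isPowerful_neg (hD : IsLocallyNilpotent D) {f : A}
    (hf : IsPowerful D f) : IsPowerful D (-f) := by
  rw [← neg_one_mul]
  exact hD.isPowerful_mul (isPowerful_of_apply_eq_zero (by simp)) hf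

/-- The common divisor is f^(n-1), and n ≤ 2(n-1) is the point where exponents at least 2 enter. -/
theorem IsLocallyNilpotent.isPowerful_pow (hD : IsLocallyNilpotent D) (f : A) {n : ℕ}
    (hn : 2 ≤ n) : IsPowerful D (f ^ n) := by
  by_cases h0 : f = 0
  · exact isPowerful_of_apply_eq_zero (by rw [h0, zero_pow (by omega), map_zero])
  refine ⟨f ^ (n - 1), pow_dvd_pow _ (by omega), ?_, ?_⟩
  · rw [D.leibniz_pow, smul_eq_mul, nsmul_eq_mul]
    exact (dvd_mul_right _ _).mul_left _
  · rw [hD.nilDegree_pow h0, hD.nilDegree_pow h0, ← mul_assoc]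
    exact Nat.mul_le_mul_right _ (by omega)

theorem IsLocallyNilpotent.isPowerful_prod_pow (hD : IsLocallyNilpotent D) {ι : Type*}
    (s : Finset ι) (f : ι → A) (n : ι → ℕ) (hn : ∀ i, 2 ≤ n i) :
    IsPowerful D (∏ i ∈ s, f i ^ n i) := by
  classical
  induction s using Finset.induction_on with
  | empty => exact isPowerful_of_apply_eq_zero (by simp)
  | insert i s hi ih =>
    rw [Finset.prod_insert hi]
    exact hD.isPowerful_mul (hD.isPowerful_pow _ (hn i)) ih

/-- A version of the Mason–Stothers inequality: a sum of two powerful elements that lies in the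
kernel is trivial. -/
theorem IsLocallyNilpotent.apply_eq_zero_of_add (hD : IsLocallyNilpotent D) {f g : A}
    (hf : IsPowerful D f) (hg : IsPowerful D g) (hfg : D (f + g) = 0) (h0 : f + g ≠ 0) :
    D f = 0 := by
  by_contra hDf
  obtain ⟨R, hRf, hR', hR⟩ := hf
  obtain ⟨S, hSg, hS', hS⟩ := hg
  have hDg : D g = -D f := by
    rw [map_add] at hfg
    linear_combination hfg
  have hf0 : f ≠ 0 := by rintro rfl; simp at hDf
  have hg0 : g ≠ 0 := by rintro rfl; simp at hDg; exact hDf hDg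
  have hDf0 : (f + g) * D f ≠ 0 := mul_ne_zero h0 hDf
  -- As D g = -D f, both R and S divide D f, so RS divides f·D f and g·D f. With n the common degree
  -- of f and g, the right side has degree n - 1, while powerfulness gives deg R + deg S ≥ n.
  have hdvd : R * S ∣ (f + g) * D f := by
    rw [add_mul]
    refine dvd_add (mul_dvd_mul hRf ?_) ?_
    · rwa [← dvd_neg, ← hDg]
    · rw [mul_comm R]
      exact mul_dvd_mul hSg hR'
  have h1 := hD.nilDegree_le_of_dvd hdvd hDf0
  have hRS := ne_zero_of_dvd_ne_zero hDf0 hdvd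
  rw [hD.nilDegree_mul (left_ne_zero_of_mul hRS) (right_ne_zero_of_mul hRS),
    hD.nilDegree_mul h0 hDf, nilDegree_eq_zero_of_apply_eq_zero hfg] at h1
  have h2 := hD.nilDegree_apply hDf
  have h3 := hD.nilDegree_apply (f := g) (by rw [hDg]; exact neg_ne_zero.2 hDf)
  have h4 : nilDegree D (-D f) = nilDegree D (D f) := by
    have : nilDegree D (-1 : A) = 0 := nilDegree_eq_zero_of_apply_eq_zero (by simp)
    rw [neg_eq_neg_one_mul, hD.nilDegree_mul (by simp) hDf, this, zero_add]
  rw [hDg, h4] at h3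
  omega

theorem IsLocallyNilpotent.nilDegree_add_mul (hD : IsLocallyNilpotent D) {f c V : A}
    (hf : D f = 0) (hc : D c = 0) (hc0 : c ≠ 0) (hV : D V ≠ 0) :
    nilDegree D (f + c * V) = nilDegree D V := by
  have h : D (f + c * V) = c * D V := by simp [hf, hc]
  have h0 : c * D V ≠ 0 := mul_ne_zero hc0 hV
  have h1 := hD.nilDegree_apply (f := f + c * V) (by rwa [h])
  rw [h, hD.nilDegree_mul hc0 hV, nilDegree_eq_zero_of_apply_eq_zero hc, zero_add,
    hD.nilDegree_apply hV] at h1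
  exact h1.symm

omit [CharZero A] in
theorem sub_mul_sub_dvd_pow_add_pow {U V a b : A} {g : ℕ} (hab : a ≠ b) (hV : V ≠ 0)
    (ha : a ^ g = -1) (hb : b ^ g = -1) :
    (U - a * V) * (U - b * V) ∣ U ^ g + V ^ g := by
  have hroot : ∀ c : A, c ^ g = -1 →
      (Polynomial.X ^ g + Polynomial.C (V ^ g)).eval (c * V) = 0 := by
    intro c hc
    simp [mul_pow, hc]
  obtain ⟨q, hq⟩ := Polynomial.dvd_iff_isRoot.2 (hroot a ha)
  have hqb := hroot b hb
  rw [hq, Polynomial.eval_mul] at hqb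
  have hba : b * V - a * V ≠ 0 := by
    rw [← sub_mul]
    exact mul_ne_zero (sub_ne_zero.2 hab.symm) hV
  have hqb' : q.eval (b * V) = 0 := by simpa [hba] using hqb
  obtain ⟨r, hr⟩ := Polynomial.dvd_iff_isRoot.2 hqb'
  refine ⟨r.eval U, ?_⟩
  have := congrArg (Polynomial.eval U) hq
  rw [hr] at this
  simpa [mul_assoc] using this

omit [IsDomain A] [CharZero A] in
-- In characteristic zero -1 has g distinct g-th roots. Discarding δ leaves at least two, unless g =
-- 2 and δ is one of them.
theorem exists_two_roots_of_neg_one [IsAlgClosed K] [CharZero K] {g : ℕ} (hg : 2 ≤ g) (δ : K)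
    (hδ : g = 2 → δ ^ 2 ≠ -1) :
    ∃ a b : K, a ≠ b ∧ a ^ g = -1 ∧ b ^ g = -1 ∧ a ≠ δ ∧ b ≠ δ := by
  classical
  set P : Polynomial K := Polynomial.X ^ g - Polynomial.C (-1) with hP
  have hmem : ∀ a, a ∈ P.roots.toFinset ↔ a ^ g = -1 := by
    intro a
    rw [Multiset.mem_toFinset, Polynomial.mem_roots (Polynomial.X_pow_sub_C_ne_zero (by omega) _)]
    simp [Polynomial.IsRoot, add_eq_zero_iff_eq_neg]
  have hcard : P.roots.toFinset.card = g := by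
    have hsep : P.Separable := Polynomial.separable_X_pow_sub_C _ (by
      exact_mod_cast (by omega : g ≠ 0)) (by simp)
    rw [Multiset.toFinset_card_of_nodup (Polynomial.nodup_roots hsep),
      IsAlgClosed.card_roots_eq_natDegree, hP, Polynomial.natDegree_X_pow_sub_C]
  have hcard' : 1 < (P.roots.toFinset.erase δ).card := by
    by_cases h : δ ∈ P.roots.toFinset
    · rw [Finset.card_erase_of_mem h, hcard]
      rcases hg.eq_or_lt with rfl | hg
      · exact absurd ((hmem δ).1 h) (hδ rfl)
      · omega
    · rw [Finset.erase_eq_of_notMem h, hcard]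
      omega
  obtain ⟨a, ha, b, hb, hab⟩ := Finset.one_lt_card.1 hcard'
  rw [Finset.mem_erase, hmem] at ha hb
  exact ⟨a, b, hab, ha.2, hb.2, ha.1, hb.1⟩

/-- Put W = U^g + V^g. If D V ≠ 0, two linear factors of W other than U - δV give deg W ≥ 2 deg V.
But modulo kernel factors the common divisor of W and D W divides D V, so its degree is at most deg
V - 1, too small for W to be powerful. Only g = 2 with δ² = -1 lacks two such factors. -/
theorem IsLocallyNilpotent.apply_eq_zero_of_linearForm [IsAlgClosed K] [CharZero K]
    (hD : IsLocallyNilpotent D) {U V : A} {δ : K} {g : ℕ} (hg : 2 ≤ g) (hδ : δ ≠ 0)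
    (h : D (U - algebraMap K A δ * V) = 0) (h0 : U - algebraMap K A δ * V ≠ 0)
    (hW : IsPowerful D (U ^ g + V ^ g)) (hW0 : U ^ g + V ^ g ≠ 0)
    (hUV : g = 2 → IsPowerful D U ∨ IsPowerful D V) : D V = 0 := by
  by_contra hV
  have hinj := (algebraMap K A).injective
  set d := algebraMap K A δ with hd
  have hDd : D d = 0 := D.map_algebraMap δ
  have hd0 : d ≠ 0 := (map_ne_zero_iff _ hinj).2 hδ
  have hDU : D U = d * D V := by
    simp only [map_sub, D.leibniz, hDd, smul_eq_mul, mul_zero, add_zero] at h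
    linear_combination h
  have hDU0 : D U ≠ 0 := by
    rw [hDU]
    exact mul_ne_zero hd0 hV
  have hV0 : V ≠ 0 := by
    rintro rfl
    simp at hV
  -- Here U - δV itself divides U² + V². A kernel multiple of U or of V, whichever is powerful,
  -- completes U² + V² to plus or minus the square of U - δV, so that `apply_eq_zero_of_add`
  -- applies.
  by_cases hs : g = 2 ∧ δ ^ 2 = -1
  · obtain ⟨rfl, hδ2⟩ := hs
    have hd2 : d ^ 2 = -1 := by rw [hd, ← map_pow, hδ2, map_neg, map_one]
    have hD2 : D (2 : A) = 0 := by simpa using D.map_natCast 2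
    have hf2 : D ((U - d * V) ^ 2) = 0 := by rw [D.leibniz_pow, h]; simp
    have hk : ∀ c : A, D c = 0 → D (c * (U - d * V)) = 0 := by
      intro c hc
      rw [D.leibniz, h, hc]
      simp
    rcases hUV rfl with hU | hV'
    · have hpow : IsPowerful D (-2 * (U - d * V) * U) :=
        hD.isPowerful_mul (isPowerful_of_apply_eq_zero (hk _ (by simp [hD2]))) hU
      have hsum : -2 * (U - d * V) * U + (U ^ 2 + V ^ 2) = -(U - d * V) ^ 2 := by
        linear_combination V ^ 2 * hd2
      have := hD.apply_eq_zero_of_add hpow hW (by rw [hsum, map_neg, hf2, neg_zero])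
        (by rw [hsum]; exact neg_ne_zero.2 (pow_ne_zero 2 h0))
      exact hDU0 (hD.apply_eq_zero_of_dvd (Dvd.intro_left _ rfl) (mul_ne_zero (mul_ne_zero
        (by simp) h0) (by rintro rfl; simp at hDU0)) this)
    · have hpow : IsPowerful D (-2 * d * (U - d * V) * V) :=
        hD.isPowerful_mul (isPowerful_of_apply_eq_zero (hk _ (by
          rw [D.leibniz, hDd]; simp [hD2]))) hV'
      have hsum : -2 * d * (U - d * V) * V + (U ^ 2 + V ^ 2) = (U - d * V) ^ 2 := by
        linear_combination V ^ 2 * hd2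
      have := hD.apply_eq_zero_of_add hpow hW (by rw [hsum, hf2])
        (by rw [hsum]; exact pow_ne_zero 2 h0)
      exact hV (hD.apply_eq_zero_of_dvd (Dvd.intro_left _ rfl) (mul_ne_zero (mul_ne_zero
        (mul_ne_zero (by simp) hd0) h0) hV0) this)
  obtain ⟨α, β, hαβ, hα, hβ, hαδ, hβδ⟩ := exists_two_roots_of_neg_one hg δ
    fun h2 h2' => hs ⟨h2, h2'⟩
  have hdeg : ∀ γ : K, γ ≠ δ → nilDegree D (U - algebraMap K A γ * V) = nilDegree D V ∧
      U - algebraMap K A γ * V ≠ 0 := by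
    intro γ hγ
    have hc0 : algebraMap K A (δ - γ) ≠ 0 := (map_ne_zero_iff _ hinj).2 (sub_ne_zero.2 hγ.symm)
    have heq : U - algebraMap K A γ * V = (U - d * V) + algebraMap K A (δ - γ) * V := by
      rw [map_sub]
      ring
    refine ⟨?_, ?_⟩
    · rw [heq]
      exact hD.nilDegree_add_mul h (D.map_algebraMap _) hc0 hV
    · intro h'
      have : D (U - algebraMap K A γ * V) = algebraMap K A (δ - γ) * D V := by
        rw [heq, map_add, h, D.leibniz, D.map_algebraMap]
        simp
      rw [h', map_zero] at this
      exact mul_ne_zero hc0 hV this.symm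
  have hpow : ∀ γ : K, γ ^ g = -1 → algebraMap K A γ ^ g = -1 := fun γ hγ => by
    rw [← map_pow, hγ, map_neg, map_one]
  -- Each of the two factors is a kernel element plus a nonzero scalar multiple of V, so it has the
  -- degree of V.
  have hdvd := sub_mul_sub_dvd_pow_add_pow (U := U) (hinj.ne hαβ) hV0 (hpow α hα) (hpow β hβ)
  have hle := hD.nilDegree_le_of_dvd hdvd hW0
  rw [hD.nilDegree_mul (hdeg α hαδ).2 (hdeg β hβδ).2, (hdeg α hαδ).1, (hdeg β hβδ).1] at hle
  obtain ⟨R, hRW, hRDW, hR⟩ := hW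
  obtain ⟨k, rfl⟩ : ∃ k, g = k + 1 := ⟨g - 1, by omega⟩
  set E := d * U ^ k + V ^ k with hE
  have hRE : R ∣ E * D V := by
    have hDW : D (U ^ (k + 1) + V ^ (k + 1)) = (k + 1 : ℕ) * (E * D V) := by
      rw [map_add, D.leibniz_pow, D.leibniz_pow, hDU, hE]
      simp only [smul_eq_mul, nsmul_eq_mul, Nat.add_sub_cancel]
      ring
    have hunit : IsUnit ((k + 1 : ℕ) : A) := by
      rw [← map_natCast (algebraMap K A)]
      exact (IsUnit.mk0 _ (by exact_mod_cast k.succ_ne_zero)).map _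
    rw [hDW] at hRDW
    exact hunit.dvd_mul_left.1 hRDW
  -- Since D U = δ·D V, the derivative of W is g·E·D V. Eliminating between W·D V and E·D V isolates
  -- U^k and V^k; the ideal they generate contains the kernel element (U - δV)^(2k), so R divides a
  -- kernel element times D V.
  have hRU : R ∣ (U - d * V) * D V * U ^ k := by
    have : (U - d * V) * D V * U ^ k =
        (U ^ (k + 1) + V ^ (k + 1)) * D V - V * (E * D V) := by
      rw [hE]
      ring
    rw [this]
    exact dvd_sub (hRW.mul_right _) (hRE.mul_left _)
  have hRV : R ∣ (U - d * V) * D V * V ^ k := by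
    have : (U - d * V) * D V * V ^ k =
        U * (E * D V) - d * (U ^ (k + 1) + V ^ (k + 1)) * D V := by
      rw [hE]
      ring
    rw [this]
    exact dvd_sub (hRE.mul_left _) ((hRW.mul_left _).mul_right _)
  have hmem : (U - d * V) ^ (2 * k) ∈ Ideal.span {U ^ k, V ^ k} := by
    rw [sub_eq_add_neg]
    apply Ideal.add_pow_mem_of_pow_mem_of_le (m := k) (n := k)
    · exact Ideal.subset_span (by simp)
    · rw [← neg_mul, mul_pow]
      exact Ideal.mul_mem_left _ _ (Ideal.subset_span (by simp))
    · omega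
  obtain ⟨s, t, hst⟩ := Ideal.mem_span_pair.1 hmem
  have hRf : R ∣ (U - d * V) ^ (2 * k + 1) * D V := by
    have : (U - d * V) ^ (2 * k + 1) * D V =
        s * ((U - d * V) * D V * U ^ k) + t * ((U - d * V) * D V * V ^ k) := by
      rw [pow_succ, ← hst]
      ring
    rw [this]
    exact dvd_add (hRU.mul_left _) (hRV.mul_left _)
  have hfin := hD.nilDegree_le_of_dvd hRf (mul_ne_zero (pow_ne_zero _ h0) hV)
  rw [hD.nilDegree_mul (pow_ne_zero _ h0) hV, hD.nilDegree_pow h0,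
    nilDegree_eq_zero_of_apply_eq_zero h] at hfin
  have := hD.nilDegree_apply hV
  omega

end LocallyNilpotent

/-! ### Homogeneous components of derivations -/

section Graded

variable {K A Γ : Type*} [Field K] [CommRing A] [Algebra K A] [AddCommGroup Γ] [DecidableEq Γ]
  (𝒜 : Γ → Submodule K A) [GradedAlgebra 𝒜]

theorem proj_of_mem {a : A} {g : Γ} (ha : a ∈ 𝒜 g) : GradedAlgebra.proj 𝒜 g a = a := by
  rw [GradedAlgebra.proj_apply, DirectSum.decompose_of_mem_same 𝒜 ha]

theorem proj_of_mem_ne {a : A} {g h : Γ} (ha : a ∈ 𝒜 g) (hgh : g ≠ h) :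
    GradedAlgebra.proj 𝒜 h a = 0 := by
  rw [GradedAlgebra.proj_apply, DirectSum.decompose_of_mem_ne 𝒜 ha hgh]

theorem proj_mem (a : A) (g : Γ) : GradedAlgebra.proj 𝒜 g a ∈ 𝒜 g := by
  rw [GradedAlgebra.proj_apply]
  exact SetLike.coe_mem _

theorem proj_mul_of_mem_left {a b : A} {g : Γ} (ha : a ∈ 𝒜 g) (h : Γ) :
    GradedAlgebra.proj 𝒜 (g + h) (a * b) = a * GradedAlgebra.proj 𝒜 h b := by
  rw [GradedAlgebra.proj_apply, GradedAlgebra.proj_apply,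
    DirectSum.coe_decompose_mul_add_of_left_mem 𝒜 ha]

theorem eq_zero_of_forall_proj_eq_zero {a : A} (h : ∀ g, GradedAlgebra.proj 𝒜 g a = 0) :
    a = 0 := by
  apply (DirectSum.decompose 𝒜).injective
  rw [DirectSum.decompose_zero]
  ext g
  rw [← GradedAlgebra.proj_apply, h]
  rfl

/-- An additive property which holds for homogeneous elements holds for sums of homogeneous
components. -/
theorem induction_on_proj {P : A → Prop} (a : A) (h0 : P 0) (hadd : ∀ a b, P a → P b → P (a + b))
    (h : ∀ g, P (GradedAlgebra.proj 𝒜 g a)) : P a := by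
  classical
  rw [← DirectSum.sum_support_decompose 𝒜 a]
  refine Finset.sum_induction _ P hadd h0 fun g _ => ?_
  rw [← GradedAlgebra.proj_apply]
  exact h g

/-- The homogeneous component of degree `e` of a derivation, as a linear map. -/
noncomputable def homCompLinear (D : Derivation K A A) (e : Γ) : A →ₗ[K] A :=
  DirectSum.toModule K Γ A
    (fun g => GradedAlgebra.proj 𝒜 (g + e) ∘ₗ (D : A →ₗ[K] A) ∘ₗ (𝒜 g).subtype) ∘ₗ
    (DirectSum.decomposeLinearEquiv 𝒜).toLinearMap

theorem homCompLinear_of_mem (D : Derivation K A A) (e : Γ) {a : A} {g : Γ} (ha : a ∈ 𝒜 g) :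
    homCompLinear 𝒜 D e a = GradedAlgebra.proj 𝒜 (g + e) (D a) := by
  simp only [homCompLinear, LinearMap.comp_apply, LinearEquiv.coe_coe,
    DirectSum.decomposeLinearEquiv_apply]
  rw [DirectSum.decompose_of_mem 𝒜 ha]
  exact DirectSum.toModule_lof (M := fun g => 𝒜 g) K g ⟨a, ha⟩

/-- The homogeneous component of degree `e` of a derivation. -/
noncomputable def homComp (D : Derivation K A A) (e : Γ) : Derivation K A A :=
  Derivation.mk' (homCompLinear 𝒜 D e) fun a b => by
    refine DirectSum.Decomposition.inductionOn 𝒜 (by simp) (fun {g} a => ?_)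
      (fun a a' ha ha' => ?_) a
    · refine DirectSum.Decomposition.inductionOn 𝒜 (by simp) (fun {h} b => ?_)
        (fun b b' hb hb' => ?_) b
      · rw [homCompLinear_of_mem 𝒜 D e (SetLike.mul_mem_graded a.2 b.2),
          homCompLinear_of_mem 𝒜 D e a.2, homCompLinear_of_mem 𝒜 D e b.2, D.leibniz, map_add,
          smul_eq_mul, smul_eq_mul, smul_eq_mul, smul_eq_mul,
          ← proj_mul_of_mem_left 𝒜 a.2, ← proj_mul_of_mem_left 𝒜 b.2]
        congr 3 <;> abel
      · simp only [mul_add, map_add, hb, hb', smul_eq_mul]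
        ring
    · simp only [add_mul, map_add, ha, ha', smul_eq_mul]
      ring

variable {𝒜}
variable {D : Derivation K A A}

theorem homComp_of_mem (e : Γ) {a : A} {g : Γ} (ha : a ∈ 𝒜 g) :
    homComp 𝒜 D e a = GradedAlgebra.proj 𝒜 (g + e) (D a) :=
  homCompLinear_of_mem 𝒜 D e ha

theorem homComp_mem (e : Γ) {a : A} {g : Γ} (ha : a ∈ 𝒜 g) : homComp 𝒜 D e a ∈ 𝒜 (g + e) := by
  rw [homComp_of_mem e ha]
  exact proj_mem 𝒜 _ _

theorem proj_apply_of_mem {a : A} {g : Γ} (ha : a ∈ 𝒜 g) (h : Γ) :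
    GradedAlgebra.proj 𝒜 h (D a) = homComp 𝒜 D (h - g) a := by
  rw [homComp_of_mem _ ha, add_sub_cancel]

variable [LinearOrder Γ]

/-- A nonzero derivation of an algebra generated by finitely many homogeneous elements has a
nonzero homogeneous component of largest degree. -/
theorem exists_top_homComp {ι : Type*} [Finite ι] (x : ι → A) (w : ι → Γ)
    (hx : ∀ i, x i ∈ 𝒜 (w i)) (hgen : Algebra.adjoin K (Set.range x) = ⊤) (hD : D ≠ 0) :
    ∃ u, homComp 𝒜 D u ≠ 0 ∧ ∀ e, u < e → homComp 𝒜 D e = 0 := by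
  classical
  have hext : ∀ D' : Derivation K A A, (∀ i, D' (x i) = 0) → D' = 0 := by
    intro D' h
    refine Derivation.ext_of_adjoin_eq_top _ hgen ?_
    rintro _ ⟨i, rfl⟩
    simpa using h i
  set S : Set Γ := {e | homComp 𝒜 D e ≠ 0} with hS
  have hfin : S.Finite := by
    -- A nonzero component is nonzero on some generator, and each D (x i) has only finitely many
    -- components.
    have : S ⊆ ⋃ i, (fun g => g - w i) '' ((DirectSum.decompose 𝒜 (D (x i))).support : Set Γ) := by
      intro e he
      obtain ⟨i, hi⟩ : ∃ i, homComp 𝒜 D e (x i) ≠ 0 := by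
        by_contra! h
        exact he (hext _ h)
      refine Set.mem_iUnion.2 ⟨i, w i + e, ?_, by simp⟩
      rw [homComp_of_mem e (hx i), GradedAlgebra.proj_apply] at hi
      simpa using hi
    exact (Set.finite_iUnion fun i => (Finset.finite_toSet _).image _).subset this
  have hne : S.Nonempty := by
    by_contra h
    rw [Set.not_nonempty_iff_eq_empty] at h
    refine hD (hext _ fun i => eq_zero_of_forall_proj_eq_zero 𝒜 fun g => ?_)
    rw [proj_apply_of_mem (hx i)]
    have : g - w i ∉ S := by simp [h]
    rw [hS, Set.mem_ofPred_eq, not_not] at this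
    rw [this]
    rfl
  obtain ⟨u, hu, hmax⟩ := hfin.exists_maximal hne
  refine ⟨u, hu, fun e he => ?_⟩
  by_contra h
  exact absurd (hmax h he.le) (not_le.2 he)

variable [IsOrderedAddMonoid Γ]

/-- Only the highest component of D applied to the highest component of a can reach degree g + u,
and nothing goes beyond. -/
theorem proj_apply_top {u : Γ} (hu : ∀ e, u < e → homComp 𝒜 D e = 0) {g : Γ} {a : A}
    (ha : ∀ h, g < h → GradedAlgebra.proj 𝒜 h a = 0) :
    (∀ h, g + u < h → GradedAlgebra.proj 𝒜 h (D a) = 0) ∧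
      GradedAlgebra.proj 𝒜 (g + u) (D a) = homComp 𝒜 D u (GradedAlgebra.proj 𝒜 g a) := by
  classical
  have key : ∀ h, g + u ≤ h → GradedAlgebra.proj 𝒜 h (D a) =
      homComp 𝒜 D (h - g) (GradedAlgebra.proj 𝒜 g a) := by
    intro h hh
    conv_lhs => rw [← DirectSum.sum_support_decompose 𝒜 a, map_sum, map_sum]
    rw [Finset.sum_eq_single g]
    · rw [proj_apply_of_mem (SetLike.coe_mem _), GradedAlgebra.proj_apply]
    · intro k hk hkg
      have hkg' : k < g := by
        refine lt_of_le_of_ne ?_ hkg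
        by_contra! hlt
        have := ha k hlt
        rw [GradedAlgebra.proj_apply] at this
        simp only [DFinsupp.mem_support_toFun, ne_eq] at hk
        exact hk (Subtype.ext this)
      rw [proj_apply_of_mem (SetLike.coe_mem _), hu]
      · rfl
      · rw [lt_sub_iff_add_lt]
        calc u + k < u + g := by gcongr
          _ = g + u := add_comm _ _
          _ ≤ h := hh
    · intro hg
      simp only [DFinsupp.mem_support_toFun, ne_eq, not_not] at hg
      rw [hg]
      simp
  refine ⟨fun h hh => ?_, ?_⟩
  · rw [key h hh.le, hu _ (by rwa [lt_sub_iff_add_lt, add_comm])]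
    rfl
  · rw [key _ le_rfl, add_sub_cancel_left]

/-- On a homogeneous element of degree g, the n-th iterate of the highest component is the component
of degree g + nu of the n-th iterate of D, hence zero for large n. -/
theorem isLocallyNilpotent_homComp (hD : IsLocallyNilpotent D) {u : Γ}
    (hu : ∀ e, u < e → homComp 𝒜 D e = 0) : IsLocallyNilpotent (homComp 𝒜 D u) := by
  have hom : ∀ (g : Γ) (a : A), a ∈ 𝒜 g → ∃ n, (homComp 𝒜 D u)^[n] a = 0 := by
    intro g a ha
    have key : ∀ n : ℕ, (∀ h, g + n • u < h → GradedAlgebra.proj 𝒜 h (D^[n] a) = 0) ∧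
        GradedAlgebra.proj 𝒜 (g + n • u) (D^[n] a) = (homComp 𝒜 D u)^[n] a := by
      intro n
      induction n with
      | zero =>
        simp only [zero_smul, add_zero, Function.iterate_zero, id]
        exact ⟨fun h hh => proj_of_mem_ne 𝒜 ha hh.ne, proj_of_mem 𝒜 ha⟩
      | succ n ih =>
        have := proj_apply_top hu ih.1
        rw [ih.2] at this
        rw [succ_nsmul, ← add_assoc, Function.iterate_succ_apply', Function.iterate_succ_apply']
        exact this
    obtain ⟨n, hn⟩ := hD a
    exact ⟨n, by rw [← (key n).2, hn, map_zero]⟩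
  intro a
  refine induction_on_proj 𝒜 (P := fun a => ∃ n, (homComp 𝒜 D u)^[n] a = 0) a ⟨0, rfl⟩ ?_ fun g => hom g _ (proj_mem 𝒜 a g)
  rintro a b ⟨m, hm⟩ ⟨n, hn⟩
  refine ⟨max m n, ?_⟩
  rw [iterate_map_add, iterate_eq_zero_of_le hm (le_max_left _ _),
    iterate_eq_zero_of_le hn (le_max_right _ _), add_zero]

end Graded

/-! ### Grading the quotient by a homogeneous polynomial -/

section QuotientGrading

variable {K σ Γ : Type*} [Field K] [AddCommGroup Γ] (w : σ → Γ)
  (F : MvPolynomial σ K)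

/-- The homogeneous pieces of the quotient of a polynomial ring by one element. -/
noncomputable def quotientPiece (g : Γ) : Submodule K (MvPolynomial σ K ⧸ Ideal.span {F}) :=
  (weightedHomogeneousSubmodule K w g).map
    (Ideal.Quotient.mkₐ K (Ideal.span {F})).toLinearMap

variable {w F}

theorem mk_mem_quotientPiece {φ : MvPolynomial σ K} {g : Γ} (h : IsWeightedHomogeneous w φ g) :
    Ideal.Quotient.mk (Ideal.span {F}) φ ∈ quotientPiece w F g :=
  ⟨φ, h, rfl⟩

theorem exists_of_mem_quotientPiece {f : MvPolynomial σ K ⧸ Ideal.span {F}} {g : Γ}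
    (h : f ∈ quotientPiece w F g) :
    ∃ φ, IsWeightedHomogeneous w φ g ∧ Ideal.Quotient.mk (Ideal.span {F}) φ = f := by
  obtain ⟨φ, hφ, rfl⟩ := h
  exact ⟨φ, hφ, rfl⟩

instance quotientPiece_gradedMonoid : SetLike.GradedMonoid (quotientPiece w F) where
  one_mem := mk_mem_quotientPiece (isWeightedHomogeneous_one K w)
  mul_mem := by
    rintro i j _ _ ⟨φ, hφ, rfl⟩ ⟨ψ, hψ, rfl⟩
    exact mk_mem_quotientPiece (IsWeightedHomogeneous.mul hφ hψ)

variable [DecidableEq Γ]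

attribute [local instance] MvPolynomial.weightedGradedAlgebra

variable (w F) in
/-- The decomposition of a polynomial into the classes of its homogeneous components. -/
noncomputable def quotientDecomposeAux :
    MvPolynomial σ K →ₗ[K] DirectSum Γ fun g => quotientPiece w F g :=
  DirectSum.toModule K Γ _ (fun g => DirectSum.lof K Γ (fun g => quotientPiece w F g) g ∘ₗ
    (Ideal.Quotient.mkₐ K (Ideal.span {F})).toLinearMap.submoduleMap
      (weightedHomogeneousSubmodule K w g)) ∘ₗ
    (DirectSum.decomposeLinearEquiv (weightedHomogeneousSubmodule K w)).toLinearMap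

theorem quotientDecomposeAux_of_mem {φ : MvPolynomial σ K} {g : Γ}
    (h : IsWeightedHomogeneous w φ g) :
    quotientDecomposeAux w F φ =
      DirectSum.lof K Γ (fun g => quotientPiece w F g) g ⟨_, mk_mem_quotientPiece h⟩ := by
  simp only [quotientDecomposeAux, LinearMap.comp_apply, LinearEquiv.coe_coe,
    DirectSum.decomposeLinearEquiv_apply]
  rw [DirectSum.decompose_of_mem (weightedHomogeneousSubmodule K w) h]
  exact DirectSum.toModule_lof (M := fun g => weightedHomogeneousSubmodule K w g) K g ⟨φ, h⟩

/-- Homogeneity of F makes each component of a multiple of F again a multiple of F. This makes the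
decomposition independent of the representative. -/
theorem quotientDecomposeAux_eq_zero {d : Γ} (hF : IsWeightedHomogeneous w F d)
    {φ : MvPolynomial σ K} (h : φ ∈ Ideal.span {F}) : quotientDecomposeAux w F φ = 0 := by
  obtain ⟨k, rfl⟩ := Ideal.mem_span_singleton.1 h
  refine DirectSum.Decomposition.inductionOn (weightedHomogeneousSubmodule K w)
    (by simp) (fun {g} k => ?_) (fun k l hk hl => ?_) k
  · rw [quotientDecomposeAux_of_mem (IsWeightedHomogeneous.mul hF k.2)]
    have h0 : (⟨_, mk_mem_quotientPiece (IsWeightedHomogeneous.mul hF k.2)⟩ :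
        quotientPiece w F (d + g)) = 0 := Subtype.ext (Ideal.Quotient.eq_zero_iff_mem.2
      (Ideal.mul_mem_right _ _ (Ideal.mem_span_singleton_self F)))
    rw [h0, map_zero]
  · rw [mul_add, map_add, hk, hl, add_zero]

theorem quotientDecomposeAux_congr {d : Γ} (hF : IsWeightedHomogeneous w F d)
    {φ ψ : MvPolynomial σ K}
    (h : Ideal.Quotient.mk (Ideal.span {F}) φ = Ideal.Quotient.mk (Ideal.span {F}) ψ) :
    quotientDecomposeAux w F φ = quotientDecomposeAux w F ψ := by
  rw [← sub_add_cancel φ ψ, map_add, quotientDecomposeAux_eq_zero hF (Ideal.Quotient.eq.1 h),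
    zero_add]

theorem coe_quotientDecomposeAux (φ : MvPolynomial σ K) :
    DirectSum.coeAddMonoidHom (quotientPiece w F) (quotientDecomposeAux w F φ) =
      Ideal.Quotient.mk _ φ := by
  refine DirectSum.Decomposition.inductionOn (weightedHomogeneousSubmodule K w)
    (by simp) (fun {g} φ => ?_) (fun φ ψ hφ hψ => ?_) φ
  · rw [quotientDecomposeAux_of_mem φ.2]
    exact DirectSum.coeAddMonoidHom_of _ _ _
  · rw [map_add, map_add, hφ, hψ, map_add]

/-- The grading of the quotient of a polynomial ring by a weighted homogeneous element. -/
@[reducible] noncomputable def quotientGradedAlgebra {d : Γ} (hF : IsWeightedHomogeneous w F d) :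
    GradedAlgebra (quotientPiece w F) where
  toGradedMonoid := quotientPiece_gradedMonoid
  decompose' f := quotientDecomposeAux w F (Function.surjInv Ideal.Quotient.mk_surjective f)
  left_inv f := by
    rw [coe_quotientDecomposeAux]
    exact Function.surjInv_eq _ f
  right_inv f := by
    have h : ∀ φ, quotientDecomposeAux w F (Function.surjInv Ideal.Quotient.mk_surjective
        (Ideal.Quotient.mk (Ideal.span {F}) φ)) = quotientDecomposeAux w F φ := fun φ =>
      quotientDecomposeAux_congr hF (Function.surjInv_eq _ _)
    beta_reduce
    induction f using DirectSum.induction_on with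
    | zero =>
      rw [map_zero, ← map_zero (Ideal.Quotient.mk (Ideal.span {F})), h, map_zero]
    | of g f =>
      obtain ⟨_, φ, hφ, rfl⟩ := f
      rw [DirectSum.coeAddMonoidHom_of]
      exact (h φ).trans (quotientDecomposeAux_of_mem hφ)
    | add f f' hf hf' =>
      rw [map_add]
      obtain ⟨φ, hφ⟩ := Ideal.Quotient.mk_surjective
        (DirectSum.coeAddMonoidHom (quotientPiece w F) f)
      obtain ⟨ψ, hψ⟩ := Ideal.Quotient.mk_surjective
        (DirectSum.coeAddMonoidHom (quotientPiece w F) f')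
      rw [← hφ, h] at hf
      rw [← hψ, h] at hf'
      rw [← hφ, ← hψ, ← map_add, h, map_add, hf, hf']

end QuotientGrading

/-! ### The coordinate ring of the trinomial hypersurface -/

section CoordinateRing

variable (K : Type*) [Field K] {m p q : ℕ} (a : Fin m → ℕ) (b : Fin p → ℕ) (c : Fin q → ℕ)

/-- The quotient of the polynomial ring by the trinomial. -/
abbrev CoordRing : Type _ :=
  MvPolynomial (Coord m p q) K ⧸ Ideal.span {trinomial K a b c}

/-- The class of a coordinate function in the coordinate ring. -/
noncomputable def coordClass (v : Coord m p q) : CoordRing K a b c :=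
  Ideal.Quotient.mk _ (X v)

theorem eval_trinomial (α : Coord m p q → K) :
    eval α (trinomial K a b c) = α xIdx * ∏ i, α (yIdx i) ^ a i + ∏ j, α (zIdx j) ^ b j +
      ∏ k, α (sIdx k) ^ c k := by
  simp [trinomial]

theorem map_trinomial {R : Type*} [CommRing R] (φ : MvPolynomial (Coord m p q) K →+* R) :
    φ (trinomial K a b c) = φ (X xIdx) * ∏ i, φ (X (yIdx i)) ^ a i +
      ∏ j, φ (X (zIdx j)) ^ b j + ∏ k, φ (X (sIdx k)) ^ c k := by
  simp [trinomial]

theorem mem_hypersurface {α : Coord m p q → K} :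
    α ∈ hypersurface K a b c ↔ α xIdx * ∏ i, α (yIdx i) ^ a i + ∏ j, α (zIdx j) ^ b j +
      ∏ k, α (sIdx k) ^ c k = 0 := by
  rw [← eval_trinomial]
  rfl

/-- A point of affine space with prescribed blocks of coordinates. -/
def mkPoint {K : Type*} {m p q : ℕ} (x : K) (y : Fin m → K) (z : Fin p → K) (s : Fin q → K) :
    Coord m p q → K :=
  Sum.elim (fun _ => x) (Sum.elim y (Sum.elim z s))

/-- The trinomial is linear in x, and its two coefficients Y and Z + S are coprime. -/
theorem irreducible_trinomial [CharZero K] : Irreducible (trinomial K a b c) := by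
  classical
  have h0 : (∏ i, X (yIdx i) ^ a i : MvPolynomial (Coord m p q) K) ≠ 0 :=
    Finset.prod_ne_zero_iff.2 fun i _ => pow_ne_zero _ (X_ne_zero _)
  have hvars : ∀ (n : ℕ) (e : Fin n → ℕ) (f : Fin n → Coord m p q), (∀ i, f i ≠ xIdx) →
      (xIdx : Coord m p q) ∉ (∏ i, X (f i) ^ e i : MvPolynomial (Coord m p q) K).vars := by
    intro n e f hf h
    obtain ⟨i, -, hi⟩ := Finset.mem_biUnion.1 (vars_prod _ h)
    have := vars_pow _ _ hi
    rw [vars_X, Finset.mem_singleton] at this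
    exact hf i this.symm
  have key := irreducible_mul_X_add (∏ i, X (yIdx i) ^ a i : MvPolynomial (Coord m p q) K)
    (∏ j, X (zIdx j) ^ b j + ∏ k, X (sIdx k) ^ c k) xIdx h0
    (hvars _ _ _ fun i => by simp) (fun h => ?_) ?_
  · rw [trinomial, add_assoc, mul_comm]
    exact key
  · rcases Finset.mem_union.1 (vars_add_subset _ _ h) with h | h
    · exact hvars _ _ _ (fun i => by simp) h
    · exact hvars _ _ _ (fun i => by simp) h
  · refine IsRelPrime.prod_left fun i _ => IsRelPrime.pow_left ?_
    rw [Irreducible.isRelPrime_iff_not_dvd X_prime.irreducible]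
    rintro ⟨k, hk⟩
    -- At this point every y_i is 0 while Z + S = 2, so no y_i divides Z + S.
    have := congrArg (eval (mkPoint 1 0 1 1 : Coord m p q → K)) hk
    simp [mkPoint] at this

theorem isPrime_span_trinomial [CharZero K] :
    (Ideal.span {trinomial K a b c}).IsPrime :=
  (Ideal.span_singleton_prime (irreducible_trinomial K a b c).ne_zero).2
    (irreducible_trinomial K a b c).prime

instance [CharZero K] : IsDomain (CoordRing K a b c) :=
  (Ideal.Quotient.isDomain_iff_prime _).2 (isPrime_span_trinomial K a b c)

instance [CharZero K] : CharZero (CoordRing K a b c) :=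
  charZero_of_injective_algebraMap (algebraMap K _).injective

theorem hypersurface_eq_zeroLocus :
    hypersurface K a b c = zeroLocus K (Ideal.span {trinomial K a b c}) := by
  ext α
  rw [zeroLocus_span]
  simp [hypersurface]

theorem vanishingIdeal_hypersurface [IsAlgClosed K] [CharZero K] :
    vanishingIdeal K (hypersurface K a b c) = Ideal.span {trinomial K a b c} := by
  have := isPrime_span_trinomial K a b c
  rw [hypersurface_eq_zeroLocus]
  exact IsPrime.vanishingIdeal_zeroLocus _

variable {K a b c}

/-- Evaluation of elements of the coordinate ring at a point of the hypersurface. -/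
noncomputable def evalPoint {α : Coord m p q → K} (hα : α ∈ hypersurface K a b c) :
    CoordRing K a b c →ₐ[K] K :=
  Ideal.Quotient.liftₐ _ (aeval α) fun f hf => by
    obtain ⟨k, rfl⟩ := Ideal.mem_span_singleton.1 hf
    rw [map_mul]
    have : aeval α (trinomial K a b c) = 0 := hα
    rw [this, zero_mul]

theorem evalPoint_mk {α : Coord m p q → K} (hα : α ∈ hypersurface K a b c)
    (f : MvPolynomial (Coord m p q) K) : evalPoint hα (Ideal.Quotient.mk _ f) = eval α f :=
  rfl

theorem evalPoint_coordClass {α : Coord m p q → K} (hα : α ∈ hypersurface K a b c)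
    (v : Coord m p q) : evalPoint hα (coordClass K a b c v) = α v := by
  rw [coordClass, evalPoint_mk, eval_X]

/-- The point with x = -2 and all other coordinates 1 lies on X and has no zero coordinate. -/
theorem coordClass_ne_zero [CharZero K] (v : Coord m p q) : coordClass K a b c v ≠ 0 := by
  have hα : (mkPoint (-2) 1 1 1 : Coord m p q → K) ∈ hypersurface K a b c := by
    rw [mem_hypersurface]
    simp only [mkPoint, Sum.elim_inl, Sum.elim_inr, Pi.one_apply, one_pow, Finset.prod_const_one]
    norm_num
  intro h
  have := evalPoint_coordClass hα v
  rw [h, map_zero] at this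
  rcases v with v | v | v | v <;> simp [mkPoint] at this

variable (K a b c) in
theorem coordClass_relation :
    coordClass K a b c xIdx * ∏ i, coordClass K a b c (yIdx i) ^ a i +
      ∏ j, coordClass K a b c (zIdx j) ^ b j + ∏ k, coordClass K a b c (sIdx k) ^ c k = 0 := by
  have : Ideal.Quotient.mk (Ideal.span {trinomial K a b c}) (trinomial K a b c) = 0 :=
    Ideal.Quotient.eq_zero_iff_mem.2 (Ideal.mem_span_singleton_self _)
  rwa [map_trinomial] at this

theorem mk_eq_aeval (f : MvPolynomial (Coord m p q) K) :
    Ideal.Quotient.mk (Ideal.span {trinomial K a b c}) f = aeval (coordClass K a b c) f := by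
  have : Ideal.Quotient.mkₐ K (Ideal.span {trinomial K a b c}) = aeval (coordClass K a b c) := by
    apply MvPolynomial.algHom_ext
    intro v
    rw [aeval_X]
    rfl
  exact DFunLike.congr_fun this f

variable (K a b c) in
theorem adjoin_coordClass : Algebra.adjoin K (Set.range (coordClass K a b c)) = ⊤ := by
  rw [Algebra.adjoin_range_eq_range_aeval, eq_top_iff]
  rintro f -
  obtain ⟨φ, rfl⟩ := Ideal.Quotient.mk_surjective f
  exact ⟨φ, (mk_eq_aeval φ).symm⟩

theorem derivation_ext {D : Derivation K (CoordRing K a b c) (CoordRing K a b c)}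
    (h : ∀ v, D (coordClass K a b c v) = 0) : D = 0 := by
  refine Derivation.ext_of_adjoin_eq_top _ (adjoin_coordClass K a b c) ?_
  rintro _ ⟨v, rfl⟩
  simpa using h v

theorem isWeightedHomogeneous_trinomial {Γ : Type*} [AddCommGroup Γ] (w : Coord m p q → Γ)
    (d : Γ) (hx : w xIdx + ∑ i, a i • w (yIdx i) = d) (hz : ∑ j, b j • w (zIdx j) = d)
    (hs : ∑ k, c k • w (sIdx k) = d) : IsWeightedHomogeneous w (trinomial K a b c) d := by
  have h : ∀ (n : ℕ) (e : Fin n → ℕ) (f : Fin n → Coord m p q), IsWeightedHomogeneous w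
      (∏ i, X (f i) ^ e i : MvPolynomial (Coord m p q) K) (∑ i, e i • w (f i)) := by
    intro n e f
    exact IsWeightedHomogeneous.prod _ _ _ fun i _ => (isWeightedHomogeneous_X K w (f i)).pow (e i)
  refine IsWeightedHomogeneous.add (IsWeightedHomogeneous.add ?_ ?_) ?_
  · rw [← hx]
    exact (isWeightedHomogeneous_X K w _).mul (h _ _ _)
  · rw [← hz]
    exact h _ _ _
  · rw [← hs]
    exact h _ _ _

end CoordinateRing

/-! ### Binary forms in the kernel -/

section BinaryForms

variable {K A : Type*} [Field K] [IsAlgClosed K] [CommRing A] [Algebra K A] [IsDomain A]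
  [CharZero A] {D : Derivation K A A}

/-- A binary form times an element that lies in the kernel of a locally nilpotent derivation is
constant, or one of the linear factors of the form lies in the kernel. -/
theorem IsLocallyNilpotent.exists_linearForm (hD : IsLocallyNilpotent D) {U V M f : A}
    {P : Polynomial K} {n : ℕ} (hn : P.natDegree ≤ n)
    (hf : f = M * aeval ![U, V] (P.homogenize n)) (hf0 : f ≠ 0) (hDf : D f = 0) :
    D V = 0 ∨ (∃ δ : K, U - algebraMap K A δ * V ≠ 0 ∧ D (U - algebraMap K A δ * V) = 0) ∨
      ∃ k : K, f = algebraMap K A k * M := by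
  rcases n with _ | n
  · right; right
    obtain ⟨k, rfl⟩ : ∃ k, P = Polynomial.C k :=
      ⟨_, Polynomial.eq_C_of_natDegree_le_zero hn⟩
    refine ⟨k, ?_⟩
    rw [hf, Polynomial.homogenize_C]
    simp [mul_comm]
  rcases hn.lt_or_eq with hlt | heq
  · left
    -- A drop in the degree of P means a root at infinity: the form is divisible by V.
    have : P.homogenize (n + 1) = X 1 * P.homogenize n := by
      have := Polynomial.homogenize_mul (1 : Polynomial K) P (m := 1) (n := n) (by simp)
        (by omega)
      rwa [one_mul, Polynomial.homogenize_one, pow_one, add_comm 1] at this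
    refine hD.apply_eq_zero_of_dvd ?_ hf0 hDf
    rw [hf, this, map_mul, aeval_X]
    exact Dvd.intro _ (mul_left_comm _ _ _)
  · right; left
    -- With full degree, a root δ of P splits the factor U - δV off the form.
    obtain ⟨δ, hδ⟩ := IsAlgClosed.exists_root P
      (Polynomial.natDegree_pos_iff_degree_pos.1 (by omega)).ne'
    obtain ⟨Q, hQ⟩ := Polynomial.dvd_iff_isRoot.2 hδ
    have hQn : Q.natDegree ≤ n := by
      have hP0 : P ≠ 0 := by
        rintro rfl
        simp at heq
      have := congrArg Polynomial.natDegree hQ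
      rw [Polynomial.natDegree_mul (Polynomial.X_sub_C_ne_zero δ)
        (right_ne_zero_of_mul (hQ ▸ hP0)), Polynomial.natDegree_X_sub_C] at this
      omega
    have : P.homogenize (n + 1) = (X 0 - C δ * X 1) * Q.homogenize n := by
      have := Polynomial.homogenize_mul (Polynomial.X - Polynomial.C δ) Q (m := 1) (n := n)
        (by simp) hQn
      rw [← hQ, Polynomial.homogenize_sub, Polynomial.homogenize_X one_ne_zero,
        Polynomial.homogenize_C, add_comm 1] at this
      simpa using this
    have hdvd : U - algebraMap K A δ * V ∣ f := by
      rw [hf, this, map_mul]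
      refine Dvd.dvd.mul_left ⟨aeval ![U, V] (Q.homogenize n), ?_⟩ _
      simp [algHom_C]
    exact ⟨δ, ne_zero_of_dvd_ne_zero hf0 hdvd, hD.apply_eq_zero_of_dvd hdvd hf0 hDf⟩

end BinaryForms

/-! ### Arithmetic of exponent vectors of equal weight -/

section Exponents

variable {m p q : ℕ}

/-- The greatest common divisor of two families of positive integers. -/
theorem exists_gcd_data (hp : 1 ≤ p) {b : Fin p → ℕ} {c : Fin q → ℕ} (hb : ∀ j, 0 < b j) :
    ∃ (g : ℕ) (b' : Fin p → ℕ) (c' : Fin q → ℕ) (β : Fin p → ℤ) (κ : Fin q → ℤ), 0 < g ∧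
      (∀ j, b j = g * b' j) ∧ (∀ k, c k = g * c' k) ∧
      ∑ j, β j * b' j + ∑ k, κ k * c' k = 1 := by
  set N : Fin p ⊕ Fin q → ℤ := Sum.elim (fun j => b j) (fun k => c k) with hN
  obtain ⟨g₀, hg₀⟩ := (IsPrincipalIdealRing.principal (Ideal.span (Set.range N))).principal
  have hspan : Ideal.span (Set.range N) = Ideal.span {(g₀.natAbs : ℤ)} := by
    rw [hg₀, Ideal.submodule_span_eq, Int.span_natAbs]
  have hdvd : ∀ v, (g₀.natAbs : ℤ) ∣ N v := fun v => by
    rw [← Ideal.mem_span_singleton, ← hspan]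
    exact Ideal.subset_span ⟨v, rfl⟩
  have hb' : ∀ j, g₀.natAbs ∣ b j := fun j => 
    Int.natCast_dvd_natCast.1 (hdvd (Sum.inl j))
  have hc' : ∀ k, g₀.natAbs ∣ c k := fun k => 
    Int.natCast_dvd_natCast.1 (hdvd (Sum.inr k))
  choose b' hb' using hb'
  choose c' hc' using hc'
  have hg : 0 < g₀.natAbs := by
    rw [Nat.pos_iff_ne_zero]
    intro h
    have h1 := hb' ⟨0, hp⟩
    rw [h, zero_mul] at h1
    exact (hb ⟨0, hp⟩).ne' h1
  have hmem : (g₀.natAbs : ℤ) ∈ Ideal.span (Set.range N) := by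
    rw [hspan]
    exact Ideal.mem_span_singleton_self _
  obtain ⟨t, ht⟩ := Ideal.mem_span_range_iff_exists_fun.1 hmem
  refine ⟨g₀.natAbs, b', c', fun j => t (Sum.inl j), fun k => t (Sum.inr k), hg, hb', hc', ?_⟩
  rw [Fintype.sum_sum_type] at ht
  simp only [hN, Sum.elim_inl, Sum.elim_inr] at ht
  have hg' : (g₀.natAbs : ℤ) ≠ 0 := by exact_mod_cast hg.ne'
  apply mul_left_cancel₀ hg'
  rw [mul_one, mul_add, Finset.mul_sum, Finset.mul_sum]
  conv_rhs => rw [← ht]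
  congr 1
  · refine Finset.sum_congr rfl fun j _ => ?_
    rw [hb' j]
    push_cast
    ring
  · refine Finset.sum_congr rfl fun k _ => ?_
    rw [hc' k]
    push_cast
    ring

/-- Exponent vectors of equal weight differ by powers of the three monomials, up to taking
roots. -/
theorem exists_common_exponent {a : Fin m → ℕ} {b' : Fin p → ℕ} {c' : Fin q → ℕ} {g : ℕ}
    {β : Fin p → ℤ} {κ : Fin q → ℤ} (hp : 1 ≤ p) (hq : 1 ≤ q) (hb : ∀ j, 0 < b' j)
    (hc : ∀ k, 0 < c' k) (hβκ : ∑ j, β j * b' j + ∑ k, κ k * c' k = 1)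
    {S : Finset (Coord m p q →₀ ℕ)} (hS : S.Nonempty)
    (hy : ∀ e ∈ S, ∀ e' ∈ S, ∀ i, (e (yIdx i) - e' (yIdx i) : ℤ) = a i * (e xIdx - e' xIdx))
    (hzs : ∀ e ∈ S, ∀ e' ∈ S, ∀ j k, (c' k * (e (zIdx j) - e' (zIdx j)) +
      b' j * (e (sIdx k) - e' (sIdx k)) + g * b' j * c' k * (e xIdx - e' xIdx) : ℤ) = 0) :
    ∃ (e₀ : Coord m p q → ℕ) (n : ℕ) (l i j : (Coord m p q →₀ ℕ) → ℕ), ∀ e ∈ S,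
      g * l e + i e + j e = n ∧ e xIdx = e₀ xIdx + l e ∧
      (∀ v, e (yIdx v) = e₀ (yIdx v) + a v * l e) ∧
      (∀ v, e (zIdx v) = e₀ (zIdx v) + b' v * i e) ∧
      ∀ v, e (sIdx v) = e₀ (sIdx v) + c' v * j e := by
  -- The relations force the z-exponents to differ by b'_j·τ and the s-exponents by -c'_k·(τ + g·Δx)
  -- for one number τ. The Bézout coefficients recover τ as the difference of the values of I, so τ
  -- is an integer.
  set I : (Coord m p q →₀ ℕ) → ℤ := fun e =>
    ∑ j, β j * e (zIdx j) - ∑ k, κ k * (g * c' k * e xIdx + e (sIdx k)) with hI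
  have hz : ∀ e ∈ S, ∀ e' ∈ S, ∀ j, (e (zIdx j) - e' (zIdx j) : ℤ) = b' j * (I e - I e') := by
    intro e he e' he' j
    have hcross : ∀ j', (b' j * (e (zIdx j') - e' (zIdx j')) : ℤ) =
        b' j' * (e (zIdx j) - e' (zIdx j)) := by
      intro j'
      have h1 := hzs e he e' he' j ⟨0, hq⟩
      have h2 := hzs e he e' he' j' ⟨0, hq⟩
      have h3 : (c' ⟨0, hq⟩ : ℤ) ≠ 0 := by exact_mod_cast (hc _).ne'
      apply mul_left_cancel₀ h3
      linear_combination b' j * h2 - b' j' * h1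
    have hsum : I e - I e' = ∑ j', β j' * (e (zIdx j') - e' (zIdx j')) -
        ∑ k, κ k * (g * c' k * (e xIdx - e' xIdx) + (e (sIdx k) - e' (sIdx k))) := by
      simp only [hI, mul_sub, mul_add, Finset.sum_sub_distrib, Finset.sum_add_distrib]
      ring
    rw [hsum, mul_sub, Finset.mul_sum, Finset.mul_sum]
    have h1 : ∀ j', (b' j * (β j' * (e (zIdx j') - e' (zIdx j'))) : ℤ) =
        (β j' * b' j') * (e (zIdx j) - e' (zIdx j)) := by
      intro j'
      linear_combination β j' * hcross j'
    have h2 : ∀ k, (b' j * (κ k * (g * c' k * (e xIdx - e' xIdx) +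
        (e (sIdx k) - e' (sIdx k)))) : ℤ) = -(κ k * c' k) * (e (zIdx j) - e' (zIdx j)) := by
      intro k
      linear_combination κ k * hzs e he e' he' j k
    simp only [h1, h2]
    rw [← Finset.sum_mul, ← Finset.sum_mul, Finset.sum_neg_distrib]
    linear_combination -(e (zIdx j) - e' (zIdx j) : ℤ) * hβκ
  have hs : ∀ e ∈ S, ∀ e' ∈ S, ∀ k, (e (sIdx k) - e' (sIdx k) : ℤ) =
      c' k * ((I e' + g * e' xIdx) - (I e + g * e xIdx)) := by
    intro e he e' he' k
    have h1 := hzs e he e' he' ⟨0, hp⟩ k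
    rw [hz e he e' he'] at h1
    have h3 : (b' ⟨0, hp⟩ : ℤ) ≠ 0 := by exact_mod_cast (hb _).ne'
    apply mul_left_cancel₀ h3
    linear_combination h1
  obtain ⟨e₁, he₁, hmin₁⟩ := S.exists_min_image (fun e => e xIdx) hS
  obtain ⟨e₂, he₂, hmin₂⟩ := S.exists_min_image (fun e => I e) hS
  obtain ⟨e₃, he₃, hmin₃⟩ := S.exists_min_image (fun e => -(I e + g * e xIdx)) hS
  -- The common monomial takes its x, y part, its z part and its s part from three different
  -- minimisers, so that l, i, j are nonnegative. In g·l + i + j the contributions of e cancel,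
  -- leaving the stated n.
  refine ⟨mkPoint (e₁ xIdx) (fun v => e₁ (yIdx v)) (fun v => e₂ (zIdx v)) fun v => e₃ (sIdx v),
    (I e₃ + g * e₃ xIdx - g * e₁ xIdx - I e₂).toNat, fun e => e xIdx - e₁ xIdx,
    fun e => (I e - I e₂).toNat,
    fun e => ((I e₃ + g * e₃ xIdx) - (I e + g * e xIdx)).toNat, fun e he => ?_⟩
  have h1 : e₁ xIdx ≤ e xIdx := hmin₁ e he
  have h2 : I e₂ ≤ I e := hmin₂ e he
  have h3 : -(I e₃ + g * e₃ xIdx) ≤ -(I e + g * e xIdx) := hmin₃ e he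
  have hl : ((e xIdx - e₁ xIdx : ℕ) : ℤ) = e xIdx - e₁ xIdx := by push_cast [h1]; ring
  have hi : ((I e - I e₂).toNat : ℤ) = I e - I e₂ := Int.toNat_of_nonneg (by omega)
  have hj : (((I e₃ + g * e₃ xIdx) - (I e + g * e xIdx)).toNat : ℤ) =
      (I e₃ + g * e₃ xIdx) - (I e + g * e xIdx) := Int.toNat_of_nonneg (by linarith)
  have hgl : (0 : ℤ) ≤ g * (e xIdx - e₁ xIdx) :=
    mul_nonneg (by positivity) (by rw [← hl]; positivity)
  refine ⟨?_, ?_, fun v => ?_, fun v => ?_, fun v => ?_⟩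
  · zify
    rw [hl, hi, hj, Int.toNat_of_nonneg (by linarith)]
    ring
  · simp only [mkPoint, Sum.elim_inl]
    omega
  · simp only [mkPoint, Sum.elim_inl, Sum.elim_inr]
    zify
    rw [hl]
    linear_combination hy e he e₁ he₁ v
  · simp only [mkPoint, Sum.elim_inl, Sum.elim_inr]
    zify
    rw [hi]
    linear_combination hz e he e₂ he₂ v
  · simp only [mkPoint, Sum.elim_inr]
    zify
    rw [hj]
    linear_combination hs e he e₃ he₃ v

end Exponents

/-! ### Derivations killing x: consequences of the Mason–Stothers inequality -/

section Rigidity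

variable {K : Type*} [Field K] [CharZero K] {m p q : ℕ} {a : Fin m → ℕ} {b : Fin p → ℕ}
  {c : Fin q → ℕ} {D : Derivation K (CoordRing K a b c) (CoordRing K a b c)}

variable (K a b c) in
/-- The first monomial of the trinomial, in the coordinate ring. -/
noncomputable def monoX : CoordRing K a b c :=
  coordClass K a b c xIdx * ∏ i, coordClass K a b c (yIdx i) ^ a i

variable (K a b c) in
/-- The second monomial of the trinomial, in the coordinate ring. -/
noncomputable def monoZ : CoordRing K a b c := ∏ j, coordClass K a b c (zIdx j) ^ b j

variable (K a b c) in
/-- The third monomial of the trinomial, in the coordinate ring. -/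
noncomputable def monoS : CoordRing K a b c := ∏ k, coordClass K a b c (sIdx k) ^ c k

omit [CharZero K] in
theorem monoX_eq : monoX K a b c = -(monoZ K a b c + monoS K a b c) := by
  have := coordClass_relation K a b c
  rw [monoX, monoZ, monoS]
  linear_combination this

theorem prod_coordClass_ne_zero {n : ℕ} (e : Fin n → ℕ) (v : Fin n → Coord m p q) :
    ∏ i, coordClass K a b c (v i) ^ e i ≠ 0 :=
  Finset.prod_ne_zero_iff.2 fun _ _ => pow_ne_zero _ (coordClass_ne_zero _)

theorem monoX_ne_zero : monoX K a b c ≠ 0 :=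
  mul_ne_zero (coordClass_ne_zero _) (prod_coordClass_ne_zero _ _)

theorem IsLocallyNilpotent.apply_coordClass_of_prod (hD : IsLocallyNilpotent D) {n : ℕ}
    {e : Fin n → ℕ} {v : Fin n → Coord m p q} (he : ∀ i, 2 ≤ e i)
    (h : D (∏ i, coordClass K a b c (v i) ^ e i) = 0) (i : Fin n) :
    D (coordClass K a b c (v i)) = 0 :=
  hD.apply_eq_zero_of_dvd ((dvd_pow_self _ (two_pos.trans_le (he i)).ne').trans
    (Finset.dvd_prod_of_mem (fun i => coordClass K a b c (v i) ^ e i) (Finset.mem_univ i))) (prod_coordClass_ne_zero _ _) h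

variable (ha : ∀ i, 2 ≤ a i) (hb : ∀ j, 2 ≤ b j) (hc : ∀ k, 2 ≤ c k)
  (hD : IsLocallyNilpotent D) (hx : D (coordClass K a b c xIdx) = 0)

include ha hD hx in
-- The exponent 1 of x is harmless because x has degree 0.
theorem isPowerful_monoX : IsPowerful D (monoX K a b c) :=
  hD.isPowerful_mul (isPowerful_of_apply_eq_zero hx) (hD.isPowerful_prod_pow _ _ _ ha)

include ha hb hc hD hx in
theorem eq_zero_of_monoZ_monoS (hZ : D (monoZ K a b c) = 0) (hS : D (monoS K a b c) = 0) :
    D = 0 := by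
  have hX : D (monoX K a b c) = 0 := by rw [monoX_eq, map_neg, map_add, hZ, hS]; simp
  have hY : D (∏ i, coordClass K a b c (yIdx i) ^ a i) = 0 :=
    hD.apply_eq_zero_of_dvd (Dvd.intro_left _ rfl) monoX_ne_zero hX
  refine derivation_ext ?_
  rintro (_ | i | j | k)
  · exact hx
  · exact hD.apply_coordClass_of_prod ha hY i
  · exact hD.apply_coordClass_of_prod hb hZ j
  · exact hD.apply_coordClass_of_prod hc hS k

include ha hb hc hD hx in
-- When one of the three monomials is in the kernel, the other two are powerful with sum in the
-- kernel, so they are in the kernel too; factorial closedness then puts every coordinate there. The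
-- next two lemmas permute the roles.
theorem eq_zero_of_monoX (h : D (monoX K a b c) = 0) : D = 0 := by
  have hsum : monoZ K a b c + monoS K a b c = -monoX K a b c := by
    rw [monoX_eq, neg_neg]
  have hZ := hD.apply_eq_zero_of_add (f := monoZ K a b c) (g := monoS K a b c)
    (hD.isPowerful_prod_pow _ _ _ hb) (hD.isPowerful_prod_pow _ _ _ hc)
    (by rw [hsum, map_neg, h, neg_zero]) (by rw [hsum]; exact neg_ne_zero.2 monoX_ne_zero)
  refine eq_zero_of_monoZ_monoS ha hb hc hD hx hZ ?_
  rwa [monoX_eq, map_neg, map_add, hZ, zero_add, neg_eq_zero] at h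

include ha hb hc hD hx in
theorem eq_zero_of_monoS (h : D (monoS K a b c) = 0) : D = 0 := by
  have hsum : monoX K a b c + monoZ K a b c = -monoS K a b c := by
    rw [monoX_eq]
    ring
  exact eq_zero_of_monoX ha hb hc hD hx (hD.apply_eq_zero_of_add (isPowerful_monoX ha hD hx)
    (hD.isPowerful_prod_pow _ _ _ hb) (by rw [← monoZ, hsum, map_neg, h, neg_zero])
    (by rw [← monoZ, hsum]; exact neg_ne_zero.2 (prod_coordClass_ne_zero _ _)))

include ha hb hc hD hx in
theorem eq_zero_of_monoZ (h : D (monoZ K a b c) = 0) : D = 0 := by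
  have hsum : monoX K a b c + monoS K a b c = -monoZ K a b c := by
    rw [monoX_eq]
    ring
  exact eq_zero_of_monoX ha hb hc hD hx (hD.apply_eq_zero_of_add (isPowerful_monoX ha hD hx)
    (hD.isPowerful_prod_pow _ _ _ hc) (by rw [← monoS, hsum, map_neg, h, neg_zero])
    (by rw [← monoS, hsum]; exact neg_ne_zero.2 (prod_coordClass_ne_zero _ _)))

variable [IsAlgClosed K]

include ha hb hc hD hx in
/-- The kernel contains no nonzero linear form in the roots of the second and the third
monomial. -/
theorem eq_zero_of_linearForm {g : ℕ} {b' : Fin p → ℕ} {c' : Fin q → ℕ} (hg : 0 < g)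
    (hb' : ∀ j, b j = g * b' j) (hc' : ∀ k, c k = g * c' k)
    (hH : ¬ (((∀ j, Even (b j)) ∧ ∃ j, b j = 2) ∧ ((∀ k, Even (c k)) ∧ ∃ k, c k = 2))) {δ : K}
    (h0 : ∏ j, coordClass K a b c (zIdx j) ^ b' j -
      algebraMap K _ δ * ∏ k, coordClass K a b c (sIdx k) ^ c' k ≠ 0)
    (h : D (∏ j, coordClass K a b c (zIdx j) ^ b' j -
      algebraMap K _ δ * ∏ k, coordClass K a b c (sIdx k) ^ c' k) = 0) : D = 0 := by
  set U := ∏ j, coordClass K a b c (zIdx j) ^ b' j with hU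
  set V := ∏ k, coordClass K a b c (sIdx k) ^ c' k with hV
  have hUg : U ^ g = monoZ K a b c := by
    rw [monoZ, hU, ← Finset.prod_pow]
    exact Finset.prod_congr rfl fun j _ => by rw [← pow_mul, hb' j, mul_comm]
  have hVg : V ^ g = monoS K a b c := by
    rw [monoS, hV, ← Finset.prod_pow]
    exact Finset.prod_congr rfl fun k _ => by rw [← pow_mul, hc' k, mul_comm]
  have hpowker : ∀ f, D f = 0 → D (f ^ g) = 0 := fun f hf => by
    rw [D.leibniz_pow, hf]
    simp
  rcases eq_or_ne δ 0 with rfl | hδ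
  · rw [map_zero, zero_mul, sub_zero] at h
    exact eq_zero_of_monoZ ha hb hc hD hx (hUg ▸ hpowker U h)
  rcases (show 1 ≤ g from hg).eq_or_lt with rfl | hg2
  -- For g = 1 the elements U and V are Z and S themselves, hence powerful, and the inequality
  -- applies to U - δV directly.
  · rw [pow_one] at hUg hVg
    refine eq_zero_of_monoZ ha hb hc hD hx (hUg ▸ ?_)
    refine hD.apply_eq_zero_of_add (g := -(algebraMap K _ δ * V)) ?_ ?_
      (by rwa [← sub_eq_add_neg]) (by rwa [← sub_eq_add_neg])
    · rw [hUg]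
      exact hD.isPowerful_prod_pow _ _ _ hb
    · refine hD.isPowerful_neg (hD.isPowerful_mul (isPowerful_of_apply_eq_zero ?_) ?_)
      · exact D.map_algebraMap δ
      · rw [hVg]
        exact hD.isPowerful_prod_pow _ _ _ hc
  · refine eq_zero_of_monoS ha hb hc hD hx (hVg ▸ hpowker V ?_)
    have hsum : U ^ g + V ^ g = -monoX K a b c := by
      rw [hUg, hVg, monoX_eq, neg_neg]
    refine hD.apply_eq_zero_of_linearForm hg2 hδ h h0 ?_ ?_ ?_
    · rw [hsum]
      exact hD.isPowerful_neg (isPowerful_monoX ha hD hx)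
    · rw [hsum]
      exact neg_ne_zero.2 monoX_ne_zero
    -- For g = 2 all exponents are even. If neither U nor V were powerful, some b'_j and some c'_k
    -- would be 1, that is, some b_j = c_k = 2: the excluded case.
    · rintro rfl
      by_contra! hcon
      have key : ∀ {n : ℕ} (e : Fin n → ℕ) (v : Fin n → Coord m p q),
          (¬ IsPowerful D (∏ i, coordClass K a b c (v i) ^ e i)) → ∃ i, e i < 2 := by
        intro n e v hn
        by_contra! he
        exact hn (hD.isPowerful_prod_pow _ _ _ he)
      obtain ⟨j, hj⟩ := key _ _ hcon.1
      obtain ⟨k, hk⟩ := key _ _ hcon.2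
      refine hH ⟨⟨fun j => ?_, j, ?_⟩, fun k => ?_, k, ?_⟩
      · rw [hb' j]
        exact even_two_mul _
      · have h1 := hb' j
        have h2 := hb j
        omega
      · rw [hc' k]
        exact even_two_mul _
      · have h1 := hc' k
        have h2 := hc k
        omega

end Rigidity

/-! ### A fine grading with values in a lexicographically ordered group -/

section FullGrading

variable {K : Type*} [Field K] {m p q : ℕ} (a : Fin m → ℕ) (b : Fin p → ℕ) (c : Fin q → ℕ)

/-- A family of integral weights on the coordinates for which the trinomial is homogeneous. -/
def rawWeight : Fin m ⊕ Fin p × Fin q → Coord m p q → ℤ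
  | .inl i => mkPoint (a i : ℤ) (Pi.single i (-1)) 0 0
  | .inr (j, k) => mkPoint (b j * c k : ℤ) 0 (Pi.single j (c k : ℤ)) (Pi.single k (b j : ℤ))

/-- The group of values of the combined weight. -/
abbrev WeightGroup (m p q : ℕ) : Type :=
  Lex (Fin (Fintype.card (Fin m ⊕ Fin p × Fin q)) → ℤ)

/-- The coordinates of the combined weight. -/
noncomputable def weightCoord (i : Fin m ⊕ Fin p × Fin q) : WeightGroup m p q →+ ℤ where
  toFun γ := ofLex γ (Fintype.equivFin _ i)
  map_zero' := rfl
  map_add' _ _ := rfl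

/-- The element of the group of weights with given coordinates. -/
noncomputable def weightOf (f : Fin m ⊕ Fin p × Fin q → ℤ) : WeightGroup m p q :=
  toLex fun n => f ((Fintype.equivFin _).symm n)

theorem weightCoord_weightOf (f : Fin m ⊕ Fin p × Fin q → ℤ) (i : Fin m ⊕ Fin p × Fin q) :
    weightCoord i (weightOf f) = f i := by
  simp [weightCoord, weightOf]

theorem weight_ext {γ γ' : WeightGroup m p q} (h : ∀ i, weightCoord i γ = weightCoord i γ') :
    γ = γ' := by
  apply ofLex.injective
  funext n
  simpa [weightCoord] using h ((Fintype.equivFin _).symm n)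

/-- The combined weight of the coordinates. -/
noncomputable def fullWeight (v : Coord m p q) : WeightGroup m p q :=
  weightOf fun i => rawWeight a b c i v

theorem weightCoord_fullWeight (i : Fin m ⊕ Fin p × Fin q) (v : Coord m p q) :
    weightCoord i (fullWeight a b c v) = rawWeight a b c i v :=
  weightCoord_weightOf _ _

theorem isWeightedHomogeneous_fullWeight :
    IsWeightedHomogeneous (fullWeight a b c) (trinomial K a b c)
      (weightOf (Sum.elim 0 fun jk => b jk.1 * c jk.2)) := by
  refine isWeightedHomogeneous_trinomial _ _ ?_ ?_ ?_ <;> refine weight_ext fun i => ?_ <;>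
  simp only [map_add, map_sum, map_nsmul, weightCoord_fullWeight, weightCoord_weightOf] <;>
  rcases i with i | ⟨j, k⟩ <;>
  simp [rawWeight, mkPoint, Pi.single_apply, mul_comm]

theorem weightCoord_weight (i : Fin m ⊕ Fin p × Fin q) (e : Coord m p q →₀ ℕ) :
    weightCoord i (Finsupp.weight (fullWeight a b c) e) = ∑ v, (e v : ℤ) * rawWeight a b c i v := by
  rw [Finsupp.weight_apply, Finsupp.sum_fintype _ _ (by simp), map_sum]
  exact Finset.sum_congr rfl fun v _ => by
    rw [map_nsmul, weightCoord_fullWeight, nsmul_eq_mul]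

theorem weightCoord_weight_inl (i : Fin m) (e : Coord m p q →₀ ℕ) :
    weightCoord (.inl i) (Finsupp.weight (fullWeight a b c) e) = a i * e xIdx - e (yIdx i) := by
  rw [weightCoord_weight]
  simp [rawWeight, mkPoint, Pi.single_apply, mul_comm, sub_eq_add_neg]

theorem weightCoord_weight_inr (j : Fin p) (k : Fin q) (e : Coord m p q →₀ ℕ) :
    weightCoord (.inr (j, k)) (Finsupp.weight (fullWeight a b c) e) =
      b j * c k * e xIdx + (c k * e (zIdx j) + b j * e (sIdx k)) := by
  rw [weightCoord_weight]
  simp [rawWeight, mkPoint, Pi.single_apply, mul_comm]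

end FullGrading

/-! ### Homogeneous kernel elements are monomials -/

section Kernel

variable {K : Type*} [Field K] [CharZero K] [IsAlgClosed K] {m p q : ℕ} {a : Fin m → ℕ}
  {b : Fin p → ℕ} {c : Fin q → ℕ} {D : Derivation K (CoordRing K a b c) (CoordRing K a b c)}

omit [CharZero K] [IsAlgClosed K] in
-- The two variables stand for U and V, and l counts factors xY = -(U^g + V^g). The exponent of V is
-- determined by the total degree n.
theorem homogenize_trinomialFactor {g l i j n : ℕ} (h : g * l + i + j = n) :
    Polynomial.homogenize ((-(Polynomial.X ^ g + 1)) ^ l * Polynomial.X ^ i : Polynomial K) n =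
      (-(X 0 ^ g + X 1 ^ g)) ^ l * X 0 ^ i * X 1 ^ j := by
  apply Polynomial.homogenize_eq_of_isHomogeneous
  · rw [← h]
    refine IsHomogeneous.mul (IsHomogeneous.mul (IsHomogeneous.pow ?_ l) (isHomogeneous_X_pow 0 i))
      (isHomogeneous_X_pow 1 j)
    exact ((isHomogeneous_X_pow 0 g).add (isHomogeneous_X_pow 1 g)).neg
  · simp

variable (ha : ∀ i, 2 ≤ a i) (hb : ∀ j, 2 ≤ b j) (hc : ∀ k, 2 ≤ c k)
  (hH : ¬ (((∀ j, Even (b j)) ∧ ∃ j, b j = 2) ∧ ((∀ k, Even (c k)) ∧ ∃ k, c k = 2)))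
  (hD : IsLocallyNilpotent D) (hx : D (coordClass K a b c xIdx) = 0)

include ha hb hc hH hD hx in
/-- Homogeneous elements of the kernel are monomials. -/
theorem exists_monomial_of_apply_eq_zero (hp : 1 ≤ p) (hq : 1 ≤ q) (hD0 : D ≠ 0)
    {γ : WeightGroup m p q} {f : CoordRing K a b c}
    (hf : f ∈ quotientPiece (fullWeight a b c) (trinomial K a b c) γ) (hf0 : f ≠ 0)
    (hDf : D f = 0) :
    ∃ (k : K) (e : Coord m p q → ℕ), k ≠ 0 ∧
      f = algebraMap K _ k * ∏ v, coordClass K a b c v ^ e v ∧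
      ∀ v, D (coordClass K a b c v) ≠ 0 → e v = 0 := by
  obtain ⟨φ, hφ, rfl⟩ := exists_of_mem_quotientPiece hf
  obtain ⟨g, b', c', β, κ, hg, hb', hc', hβκ⟩ :=
    exists_gcd_data (c := c) hp fun j => two_pos.trans_le (hb j)
  have hS : φ.support.Nonempty := by
    rw [Finset.nonempty_iff_ne_empty, ne_eq, support_eq_empty]
    rintro rfl
    exact hf0 (map_zero _)
  have hw : ∀ e ∈ φ.support, ∀ i, weightCoord i (Finsupp.weight (fullWeight a b c) e) =
      weightCoord i γ := fun e he i => by rw [hφ (mem_support_iff.1 he)]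
  have hg0 : (g : ℤ) ≠ 0 := by exact_mod_cast hg.ne'
  obtain ⟨e₀, n, l, i, j, hcommon⟩ := exists_common_exponent (a := a) (g := g) hp hq
    (fun j => Nat.pos_of_mul_pos_left (a := g) (by rw [← hb' j]; exact two_pos.trans_le (hb j)))
    (fun k => Nat.pos_of_mul_pos_left (a := g) (by rw [← hc' k]; exact two_pos.trans_le (hc k)))
    hβκ hS (fun e he e' he' i => by
      have h1 := hw e he (.inl i)
      have h2 := hw e' he' (.inl i)
      rw [weightCoord_weight_inl] at h1 h2
      linear_combination h2 - h1)
    (fun e he e' he' j k => by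
      have h1 := hw e he (.inr (j, k))
      have h2 := hw e' he' (.inr (j, k))
      rw [weightCoord_weight_inr, hb' j, hc' k] at h1 h2
      push_cast at h1 h2
      apply mul_left_cancel₀ hg0
      linear_combination h1 - h2)
  set U := ∏ j, coordClass K a b c (zIdx j) ^ b' j with hU
  set V := ∏ k, coordClass K a b c (sIdx k) ^ c' k with hV
  set M := ∏ v, coordClass K a b c v ^ e₀ v with hM
  have hUV : monoX K a b c = -(U ^ g + V ^ g) := by
    rw [monoX_eq, monoZ, monoS, hU, hV, ← Finset.prod_pow, ← Finset.prod_pow]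
    simp only [hb', hc', ← pow_mul, mul_comm g]
  -- All monomials of φ share the factor M, and what remains is a form of degree n in U, V.
  have hmono : ∀ e ∈ φ.support, ∏ v, coordClass K a b c v ^ e v =
      M * ((-(U ^ g + V ^ g)) ^ l e * U ^ i e * V ^ j e) := by
    intro e he
    obtain ⟨-, h1, h2, h3, h4⟩ := hcommon e he
    rw [← hUV, monoX, hM, hU, hV, mul_pow, ← Finset.prod_pow, ← Finset.prod_pow,
      ← Finset.prod_pow]
    simp only [Fintype.prod_sum_type, Finset.univ_unique, Finset.prod_singleton]
    simp only [← pow_mul]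
    have e1 : ∏ v, coordClass K a b c (yIdx v) ^ e (yIdx v) =
        (∏ v, coordClass K a b c (yIdx v) ^ e₀ (yIdx v)) *
          ∏ v, coordClass K a b c (yIdx v) ^ (a v * l e) := by
      rw [← Finset.prod_mul_distrib]
      exact Finset.prod_congr rfl fun v _ => by rw [h2 v, pow_add]
    have e2 : ∏ v, coordClass K a b c (zIdx v) ^ e (zIdx v) =
        (∏ v, coordClass K a b c (zIdx v) ^ e₀ (zIdx v)) *
          ∏ v, coordClass K a b c (zIdx v) ^ (b' v * i e) := by
      rw [← Finset.prod_mul_distrib]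
      exact Finset.prod_congr rfl fun v _ => by rw [h3 v, pow_add]
    have e3 : ∏ v, coordClass K a b c (sIdx v) ^ e (sIdx v) =
        (∏ v, coordClass K a b c (sIdx v) ^ e₀ (sIdx v)) *
          ∏ v, coordClass K a b c (sIdx v) ^ (c' v * j e) := by
      rw [← Finset.prod_mul_distrib]
      exact Finset.prod_congr rfl fun v _ => by rw [h4 v, pow_add]
    have e4 : coordClass K a b c xIdx ^ e xIdx =
        coordClass K a b c xIdx ^ e₀ xIdx * coordClass K a b c xIdx ^ l e := by
      rw [h1, pow_add]
    change coordClass K a b c xIdx ^ e xIdx * (_ * (_ * _)) =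
      coordClass K a b c xIdx ^ e₀ xIdx * (_ * (_ * _)) * _
    rw [e1, e2, e3, e4]
    ring
  set P : Polynomial K := ∑ e ∈ φ.support, Polynomial.C (φ.coeff e) *
    ((-(Polynomial.X ^ g + 1)) ^ l e * Polynomial.X ^ i e) with hP
  have hPn : P.natDegree ≤ n := by
    refine Polynomial.natDegree_sum_le_of_forall_le _ _ fun e he => ?_
    refine (Polynomial.natDegree_C_mul_le _ _).trans ?_
    have h1 : (-(Polynomial.X ^ g + 1) : Polynomial K).natDegree ≤ g := by
      rw [Polynomial.natDegree_neg]
      compute_degree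
    have h2 := Polynomial.natDegree_pow_le_of_le (l e) h1
    have h3 := Polynomial.natDegree_mul_le_of_le h2 (Polynomial.natDegree_X_pow_le (R := K) (i e))
    refine h3.trans ?_
    have := (hcommon e he).1
    rw [mul_comm]
    omega
  have hrep : Ideal.Quotient.mk (Ideal.span {trinomial K a b c}) φ =
      M * aeval ![U, V] (P.homogenize n) := by
    rw [mk_eq_aeval, aeval_def, eval₂_eq', hP, Polynomial.homogenize_finsetSum, map_sum,
      Finset.mul_sum]
    refine Finset.sum_congr rfl fun e he => ?_
    rw [Polynomial.homogenize_C_mul, homogenize_trinomialFactor (hcommon e he).1, hmono e he]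
    simp only [map_mul, map_pow, map_neg, map_add, algHom_C, aeval_X, Matrix.cons_val_zero,
      Matrix.cons_val_one]
    ring
  -- A linear factor, V or U - δV, in the kernel would force D = 0. So the form is constant, and f
  -- is a scalar times M.
  rcases hD.exists_linearForm hPn hrep hf0 hDf with h | ⟨δ, h0, h⟩ | ⟨k, hk⟩
  · refine absurd (eq_zero_of_monoS ha hb hc hD hx ?_) hD0
    have hVg : V ^ g = monoS K a b c := by
      rw [monoS, hV, ← Finset.prod_pow]
      simp only [hc', ← pow_mul, mul_comm g]
    rw [← hVg, D.leibniz_pow, h]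
    simp
  · exact absurd (eq_zero_of_linearForm ha hb hc hD hx hg hb' hc' hH h0 h) hD0
  · refine ⟨k, e₀, ?_, hk, fun v hv => ?_⟩
    · rintro rfl
      rw [map_zero, zero_mul] at hk
      exact hf0 hk
    · by_contra hev
      refine hv (hD.apply_eq_zero_of_dvd ?_ hf0 hDf)
      rw [hk]
      exact ((dvd_pow_self _ hev).trans
        (Finset.dvd_prod_of_mem (fun v => coordClass K a b c v ^ e₀ v)
          (Finset.mem_univ v))).mul_left _

end Kernel

/-! ### Rigidity: a locally nilpotent derivation killing x is zero -/

section Rigid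

variable {K : Type*} [Field K] [CharZero K] [IsAlgClosed K] {m p q : ℕ} {a : Fin m → ℕ}
  {b : Fin p → ℕ} {c : Fin q → ℕ} {D : Derivation K (CoordRing K a b c) (CoordRing K a b c)}

/-- There is a point of the hypersurface for which exactly one given coordinate `s_k` vanishes. -/
theorem exists_point_with_unique_zero (ha : ∀ i, 2 ≤ a i) (hc : ∀ k, 2 ≤ c k) (i : Fin m)
    (k : Fin q) : ∃ α ∈ hypersurface K a b c, α (sIdx k) = 0 ∧ ∀ v, v ≠ sIdx k → α v ≠ 0 := by
  have hai := ha i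
  have hck := hc k
  obtain ⟨η, hη⟩ := IsAlgClosed.exists_pow_nat_eq (-1 : K) (n := a i) (by omega)
  have hη0 : η ≠ 0 := by
    rintro rfl
    rw [zero_pow (by omega)] at hη
    simp at hη
  refine ⟨mkPoint 1 (Pi.mulSingle i η) 1 (fun k' => if k' = k then 0 else 1), ?_, by simp [mkPoint],
    ?_⟩
  · rw [mem_hypersurface]
    have h1 : ∏ i', (Pi.mulSingle i η : Fin m → K) i' ^ a i' = -1 := by
      rw [Finset.prod_eq_single i]
      · simp [hη]
      · intro i' _ hi'
        simp [Pi.mulSingle_eq_of_ne hi']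
      · simp
    have h2 : ∏ k', (if k' = k then (0 : K) else 1) ^ c k' = 0 :=
      Finset.prod_eq_zero (Finset.mem_univ k) (by simp; omega)
    simp only [mkPoint, Sum.elim_inl, Sum.elim_inr, h1, h2, Pi.one_apply, one_pow,
      Finset.prod_const_one]
    ring
  · rintro (_ | i' | j | k') hv
    · simp [mkPoint]
    · by_cases h : i' = i
      · subst h
        simpa [mkPoint] using hη0
      · simp [mkPoint, Pi.mulSingle_eq_of_ne h]
    · simp [mkPoint]
    · have : k' ≠ k := fun h => hv (by rw [h])
      simp [mkPoint, this]

variable (ha : ∀ i, 2 ≤ a i) (hb : ∀ j, 2 ≤ b j) (hc : ∀ k, 2 ≤ c k)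
  (hH : ¬ (((∀ j, Even (b j)) ∧ ∃ j, b j = 2) ∧ ((∀ k, Even (c k)) ∧ ∃ k, c k = 2)))
  (hD : IsLocallyNilpotent D) (hx : D (coordClass K a b c xIdx) = 0)

include ha hb hc hH hD hx in
-- If D ≠ 0, it moves some y_i, z_j, s_k, so kernel monomials avoid these three. A weight supported
-- on them then determines the degree function, which makes z_j^{b_j} and s_k^{c_k} proportional
-- over the kernel. This fails at a point where s_k is the only vanishing coordinate.
theorem eq_zero_of_homogeneous (hp : 1 ≤ p) {ε : WeightGroup m p q}
    (hhom : ∀ γ, ∀ f ∈ quotientPiece (fullWeight a b c) (trinomial K a b c) γ,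
      D f ∈ quotientPiece (fullWeight a b c) (trinomial K a b c) (γ + ε)) : D = 0 := by
  by_contra hD0
  let _ := quotientGradedAlgebra (isWeightedHomogeneous_fullWeight (K := K) a b c)
  have hex : ∀ {n : ℕ} (e : Fin n → ℕ) (v : Fin n → Coord m p q),
      D (∏ i, coordClass K a b c (v i) ^ e i) ≠ 0 → ∃ i, D (coordClass K a b c (v i)) ≠ 0 := by
    intro n e v h
    by_contra! hv
    refine h (Finset.prod_induction _ (fun f => D f = 0) (fun f g hf hg => ?_) (by simp)
      fun i _ => ?_)
    · rw [D.leibniz, hf, hg]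
      simp
    · rw [D.leibniz_pow, hv i]
      simp
  -- This also disposes of q = 0, where S = 1 is always in the kernel.
  obtain ⟨k, hk⟩ := hex c sIdx fun h => hD0 (eq_zero_of_monoS ha hb hc hD hx h)
  obtain ⟨j, hj⟩ := hex b zIdx fun h => hD0 (eq_zero_of_monoZ ha hb hc hD hx h)
  obtain ⟨i, hi⟩ := hex a yIdx fun h => hD0 (eq_zero_of_monoX ha hb hc hD hx (by
    rw [monoX, D.leibniz, h, hx]
    simp))
  have hq : 1 ≤ q := by have := k.2; omega
  set z := coordClass K a b c (zIdx j) with hz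
  set s := coordClass K a b c (sIdx k) with hs
  obtain ⟨α, hα, hαk, hαv⟩ := exists_point_with_unique_zero (K := K) (b := b) ha hc i k
  have hai : (0 : ℤ) < a i := by have := ha i; omega
  have hbj : (0 : ℤ) < b j := by have := hb j; omega
  have hck : (0 : ℤ) < c k := by have := hc k; omega
  -- The combination is chosen to vanish on x. It is positive on y_i, z_j, s_k and zero on every
  -- other coordinate.
  set ω : WeightGroup m p q →+ ℤ :=
    (a i : ℤ) • weightCoord (.inr (j, k)) - (b j * c k : ℤ) • weightCoord (.inl i) with hω
  have hω_apply : ∀ γ, ω γ = a i * weightCoord (.inr (j, k)) γ -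
      b j * c k * weightCoord (.inl i) γ := fun γ => by
    simp [hω]
  have hωv : ∀ v, ω (fullWeight a b c v) = a i * rawWeight a b c (.inr (j, k)) v -
      b j * c k * rawWeight a b c (.inl i) v := fun v => by
    rw [hω_apply, weightCoord_fullWeight, weightCoord_fullWeight]
  have hωz : ω (fullWeight a b c (zIdx j)) = a i * c k := by
    rw [hωv]
    simp [rawWeight, mkPoint]
  have hωs : ω (fullWeight a b c (sIdx k)) = a i * b j := by
    rw [hωv]
    simp [rawWeight, mkPoint]
  have hker : ∀ γ, ∀ f ∈ quotientPiece (fullWeight a b c) (trinomial K a b c) γ, f ≠ 0 →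
      D f = 0 → ω γ = 0 ∧ evalPoint hα f ≠ 0 := by
    intro γ f hf hf0 hDf
    obtain ⟨r, e, hr, hfe, he⟩ :=
      exists_monomial_of_apply_eq_zero ha hb hc hH hD hx hp hq hD0 hf hf0 hDf
    constructor
    · have hmem : f ∈ quotientPiece (fullWeight a b c) (trinomial K a b c)
          (∑ v, e v • fullWeight a b c v) := by
        have hhm : IsWeightedHomogeneous (fullWeight a b c)
            (C r * ∏ v, X v ^ e v : MvPolynomial (Coord m p q) K)
            (∑ v, e v • fullWeight a b c v) :=
          (IsWeightedHomogeneous.prod _ _ _ fun v _ =>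
            (isWeightedHomogeneous_X K _ v).pow (e v)).C_mul r
        have := mk_mem_quotientPiece (F := trinomial K a b c) hhm
        rw [map_mul, map_prod] at this
        simp only [map_pow] at this
        rw [hfe]
        exact this
      have hγ : γ = ∑ v, e v • fullWeight a b c v := by
        by_contra hne
        have h1 := proj_of_mem _ hf
        rw [proj_of_mem_ne _ hmem (Ne.symm hne)] at h1
        exact hf0 h1.symm
      rw [hγ, map_sum]
      refine Finset.sum_eq_zero fun v _ => ?_
      rw [map_nsmul, hωv]
      rcases v with _ | i' | j' | k'
      · simp [rawWeight, mkPoint]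
        right
        ring
      · by_cases h : i' = i
        · subst h
          rw [he _ hi, zero_smul]
        · simp [rawWeight, mkPoint, h]
      · by_cases h : j' = j
        · subst h
          rw [he _ hj, zero_smul]
        · simp [rawWeight, mkPoint, h]
      · by_cases h : k' = k
        · subst h
          rw [he _ hk, zero_smul]
        · simp [rawWeight, mkPoint, h]
    · rw [hfe, map_mul, map_prod, AlgHom.commutes]
      refine mul_ne_zero hr (Finset.prod_ne_zero_iff.2 fun v _ => ?_)
      rw [map_pow, evalPoint_coordClass]
      by_cases h : v = sIdx k
      · rw [he v (by rwa [h]), pow_zero]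
        exact one_ne_zero
      · exact pow_ne_zero _ (hαv v h)
  have hiter : ∀ (n : ℕ) γ, ∀ f ∈ quotientPiece (fullWeight a b c) (trinomial K a b c) γ,
      D^[n] f ∈ quotientPiece (fullWeight a b c) (trinomial K a b c) (γ + n • ε) := by
    intro n
    induction n with
    | zero => intro γ f hf; simpa using hf
    | succ n ih =>
      intro γ f hf
      rw [Function.iterate_succ_apply', succ_nsmul, ← add_assoc]
      exact hhom _ _ (ih γ f hf)
  -- The last nonzero iterate of f lies in the kernel, where ω vanishes; so the nilpotency degree is
  -- proportional to ω.
  have hdeg : ∀ γ, ∀ f ∈ quotientPiece (fullWeight a b c) (trinomial K a b c) γ, f ≠ 0 →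
      ω γ + nilDegree D f * ω ε = 0 := by
    intro γ f hf hf0
    have := (hker _ _ (hiter (nilDegree D f) γ f hf) (iterate_nilDegree_ne_zero hf0) (by
      rw [← Function.iterate_succ_apply' D]
      exact hD.iterate_nilDegree_succ f)).1
    rwa [map_add, map_nsmul, nsmul_eq_mul] at this
  have hzmem : ∀ v (n : ℕ), coordClass K a b c v ^ n ∈
      quotientPiece (fullWeight a b c) (trinomial K a b c) (n • fullWeight a b c v) := by
    intro v n
    have := mk_mem_quotientPiece (F := trinomial K a b c)
      ((isWeightedHomogeneous_X K (fullWeight a b c) v).pow n)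
    rwa [map_pow] at this
  set F := z ^ b j with hF
  set G := s ^ c k with hG
  have hF0 : F ≠ 0 := pow_ne_zero _ (coordClass_ne_zero _)
  have hG0 : G ≠ 0 := pow_ne_zero _ (coordClass_ne_zero _)
  have hFmem := hzmem (zIdx j) (b j)
  have hGmem := hzmem (sIdx k) (c k)
  rw [← hz, ← hF] at hFmem
  rw [← hs, ← hG] at hGmem
  have hFdeg := hdeg _ F hFmem hF0
  have hGdeg := hdeg _ G hGmem hG0
  have hΩF : ω (b j • fullWeight a b c (zIdx j)) = a i * b j * c k := by
    rw [map_nsmul, hωz, nsmul_eq_mul]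
    ring
  have hΩG : ω (c k • fullWeight a b c (sIdx k)) = a i * b j * c k := by
    rw [map_nsmul, hωs, nsmul_eq_mul]
    ring
  have hΩ : (0 : ℤ) < a i * b j * c k := by positivity
  rw [hΩF] at hFdeg
  rw [hΩG] at hGdeg
  have hε : ω ε ≠ 0 := by
    intro h
    rw [h, mul_zero, add_zero] at hFdeg
    exact hΩ.ne' hFdeg
  have hcancel : ∀ n n' : ℕ, (n * ω ε : ℤ) = n' * ω ε → n = n' := fun n n' h => by
    exact_mod_cast mul_right_cancel₀ hε h
  have hFG : nilDegree D F = nilDegree D G := hcancel _ _ (by linarith)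
  set N := nilDegree D F with hN
  have hNF : D^[N] F ≠ 0 := iterate_nilDegree_ne_zero hF0
  have hNG : D^[N] G ≠ 0 := by
    rw [hFG]
    exact iterate_nilDegree_ne_zero hG0
  have hkF : D (D^[N] F) = 0 := by
    rw [← Function.iterate_succ_apply' D]
    exact hD.iterate_nilDegree_succ F
  have hkG : D (D^[N] G) = 0 := by
    rw [← Function.iterate_succ_apply' D, hFG]
    exact hD.iterate_nilDegree_succ G
  have hlin : ∀ (κ f : CoordRing K a b c), D κ = 0 → ∀ n, D^[n] (κ * f) = κ * D^[n] f := by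
    intro κ f hκ n
    induction n with
    | zero => rfl
    | succ n ih =>
      rw [Function.iterate_succ_apply', ih, D.leibniz, hκ, Function.iterate_succ_apply']
      simp
  -- By weight, h would have degree N if it were nonzero, but its N-th iterate cancels.
  set h := D^[N] G * F - D^[N] F * G with hh
  have hh0 : h = 0 := by
    by_contra hne
    have hmem : h ∈ quotientPiece (fullWeight a b c) (trinomial K a b c)
        (b j • fullWeight a b c (zIdx j) + c k • fullWeight a b c (sIdx k) + N • ε) := by
      refine Submodule.sub_mem _ ?_ ?_
      · have := SetLike.mul_mem_graded (hiter N _ G hGmem) hFmem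
        convert this using 1
        abel_nf
      · have := SetLike.mul_mem_graded (hiter N _ F hFmem) hGmem
        convert this using 1
        abel_nf
    have hdegh := hdeg _ h hmem hne
    rw [map_add, map_add, hΩF, hΩG, map_nsmul, nsmul_eq_mul] at hdegh
    have hNh : nilDegree D h = N := hcancel _ _ (by linarith)
    have hzero : D^[N] h = 0 := by
      rw [hh, iterate_map_sub, hlin _ _ hkG, hlin _ _ hkF, mul_comm, sub_self]
    exact iterate_nilDegree_ne_zero hne (by rw [hNh, hzero])
  -- At α the element G vanishes and F does not, and the N-th iterate of G is a kernel monomial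
  -- without s_k, so it does not vanish either.
  have heval := congrArg (evalPoint hα) hh0
  have hGα : evalPoint hα G = 0 := by
    rw [hG, map_pow, hs, evalPoint_coordClass, hαk, zero_pow]
    have := hc k
    omega
  have hFα : evalPoint hα F ≠ 0 := by
    rw [hF, map_pow, hz, evalPoint_coordClass]
    exact pow_ne_zero _ (hαv _ (by simp))
  rw [hh, map_sub, map_mul, map_mul, hGα, mul_zero, sub_zero, map_zero] at heval
  exact mul_ne_zero (hker _ _ (hiter N _ G hGmem) hNG hkG).2 hFα heval

include ha hb hc hH hD hx in
/-- A locally nilpotent derivation of the coordinate ring that annihilates `x` is zero. -/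
theorem eq_zero_of_apply_xIdx (hp : 1 ≤ p) : D = 0 := by
  by_contra hD0
  let _ := quotientGradedAlgebra (isWeightedHomogeneous_fullWeight (K := K) a b c)
  have hmem : ∀ v, coordClass K a b c v ∈
      quotientPiece (fullWeight a b c) (trinomial K a b c) (fullWeight a b c v) := fun v =>
    mk_mem_quotientPiece (isWeightedHomogeneous_X K _ v)
  obtain ⟨u, hu0, hu⟩ := exists_top_homComp (coordClass K a b c) (fullWeight a b c) hmem
    (adjoin_coordClass K a b c) hD0
  refine hu0 (eq_zero_of_homogeneous ha hb hc hH (isLocallyNilpotent_homComp hD hu) ?_ hp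
    fun γ f hf => homComp_mem u hf)
  rw [homComp_of_mem u (hmem xIdx), hx, map_zero]

end Rigid

/-! ### The gradings by a single y-coordinate -/

section YGrading

variable {K : Type*} [Field K] {m p q : ℕ} {a : Fin m → ℕ} {b : Fin p → ℕ} {c : Fin q → ℕ}

/-- The weight which is `-1` on `y_l`, `a_l` on `x` and zero on the other coordinates. -/
def yWeight (a : Fin m → ℕ) (l : Fin m) : Coord m p q → ℤ :=
  mkPoint (a l : ℤ) (Pi.single l (-1)) 0 0

theorem isWeightedHomogeneous_yWeight (l : Fin m) :
    IsWeightedHomogeneous (yWeight a l) (trinomial K a b c) 0 := by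
  refine isWeightedHomogeneous_trinomial _ _ ?_ ?_ ?_ <;>
  simp [yWeight, mkPoint, Pi.single_apply]

noncomputable instance yGradedAlgebra (l : Fin m) :
    GradedAlgebra (quotientPiece (yWeight a l) (trinomial K a b c)) :=
  quotientGradedAlgebra (isWeightedHomogeneous_yWeight l)

theorem coordClass_mem_piece {Γ : Type*} [AddCommGroup Γ] (w : Coord m p q → Γ)
    (v : Coord m p q) : coordClass K a b c v ∈ quotientPiece w (trinomial K a b c) (w v) :=
  mk_mem_quotientPiece (isWeightedHomogeneous_X K _ v)

theorem weight_yWeight (l : Fin m) (e : Coord m p q →₀ ℕ) :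
    Finsupp.weight (yWeight a l) e = (a l * e xIdx - e (yIdx l) : ℤ) := by
  rw [Finsupp.weight_apply, Finsupp.sum_fintype _ _ (by simp)]
  simp [yWeight, mkPoint, Pi.single_apply, mul_comm, sub_eq_add_neg]

theorem coordClass_pow_dvd_mk {φ : MvPolynomial (Coord m p q) K} {v : Coord m p q} {n : ℕ}
    (h : ∀ e ∈ φ.support, n ≤ e v) :
    coordClass K a b c v ^ n ∣ Ideal.Quotient.mk (Ideal.span {trinomial K a b c}) φ := by
  rw [mk_eq_aeval, aeval_def, eval₂_eq']
  refine Finset.dvd_sum fun e he => Dvd.dvd.mul_left ?_ _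
  exact (pow_dvd_pow _ (h e he)).trans
    (Finset.dvd_prod_of_mem (fun v => coordClass K a b c v ^ e v) (Finset.mem_univ v))

/-- Only x has positive weight, so it occurs in every monomial of positive degree. -/
theorem xIdx_dvd_of_mem {l : Fin m} {f : CoordRing K a b c} {g : ℤ} (hg : 0 < g)
    (hf : f ∈ quotientPiece (yWeight a l) (trinomial K a b c) g) :
    coordClass K a b c xIdx ∣ f := by
  obtain ⟨φ, hφ, rfl⟩ := exists_of_mem_quotientPiece hf
  rw [← pow_one (coordClass K a b c xIdx)]
  refine coordClass_pow_dvd_mk fun e he => ?_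
  have h := hφ (mem_support_iff.1 he)
  rw [weight_yWeight] at h
  by_contra! h0
  have h1 : e xIdx = 0 := by omega
  rw [h1] at h
  simp at h
  omega

theorem yIdx_pow_dvd_of_mem {l : Fin m} {f : CoordRing K a b c} {g : ℤ} {n : ℕ} (hg : g ≤ -n)
    (hf : f ∈ quotientPiece (yWeight a l) (trinomial K a b c) g) :
    coordClass K a b c (yIdx l) ^ n ∣ f := by
  obtain ⟨φ, hφ, rfl⟩ := exists_of_mem_quotientPiece hf
  refine coordClass_pow_dvd_mk fun e he => ?_
  have h := hφ (mem_support_iff.1 he)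
  rw [weight_yWeight] at h
  have : (0 : ℤ) ≤ a l * e xIdx := by positivity
  omega

/-- All homogeneous components of `f` have degree at most `-n`. -/
def YOrderGE (l : Fin m) (n : ℕ) (f : CoordRing K a b c) : Prop :=
  ∀ h : ℤ, -n < h → GradedAlgebra.proj (quotientPiece (yWeight a l) (trinomial K a b c)) h f = 0

theorem YOrderGE.dvd {l : Fin m} {n : ℕ} {f : CoordRing K a b c} (h : YOrderGE l n f) :
    coordClass K a b c (yIdx l) ^ n ∣ f := by
  refine induction_on_proj (quotientPiece (yWeight a l) (trinomial K a b c))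
    (P := fun f => coordClass K a b c (yIdx l) ^ n ∣ f) f (dvd_zero _)
    (fun _ _ => dvd_add) fun g => ?_
  by_cases hg : -(n : ℤ) < g
  · rw [h g hg]
    exact dvd_zero _
  · exact yIdx_pow_dvd_of_mem (not_lt.1 hg) (proj_mem _ f g)

/-- For i ≠ l the coordinate y_i has weight 0 in the l-th grading, so dividing by its powers does
not disturb the order in y_l. This replaces any coprimality argument. -/
theorem prod_yIdx_pow_dvd [CharZero K] {f : CoordRing K a b c} {n : Fin m → ℕ}
    (h : ∀ l, YOrderGE l (n l) f) : ∏ i, coordClass K a b c (yIdx i) ^ n i ∣ f := by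
  suffices ∀ s : Finset (Fin m), ∏ i ∈ s, coordClass K a b c (yIdx i) ^ n i ∣ f from
    this Finset.univ
  intro s
  induction s using Finset.induction_on with
  | empty => simp
  | insert l s hl ih =>
    obtain ⟨k, rfl⟩ := ih
    rw [Finset.prod_insert hl, mul_comm]
    refine mul_dvd_mul_left _ (YOrderGE.dvd fun g hg => ?_)
    have hmem : ∏ i ∈ s, coordClass K a b c (yIdx i) ^ n i ∈
        quotientPiece (yWeight a l) (trinomial K a b c) 0 := by
      have hhm := IsWeightedHomogeneous.prod s
        (fun i => (X (yIdx i) ^ n i : MvPolynomial (Coord m p q) K)) (fun _ => (0 : ℤ))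
        (w := yWeight a l) fun i hi => by
          have hil : i ≠ l := fun h => hl (h ▸ hi)
          have := (isWeightedHomogeneous_X K (yWeight (p := p) (q := q) a l) (yIdx i)).pow (n i)
          simpa [yWeight, mkPoint, Pi.single_apply, hil] using this
      have := mk_mem_quotientPiece (F := trinomial K a b c) hhm
      rw [map_prod, Finset.sum_const_zero] at this
      simp only [map_pow] at this
      exact this
    have h1 := h l g hg
    rw [← zero_add g, proj_mul_of_mem_left _ hmem, mul_eq_zero] at h1
    exact h1.resolve_left (Finset.prod_ne_zero_iff.2 fun _ _ =>
      pow_ne_zero _ (coordClass_ne_zero _))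

end YGrading

/-! ### Values of locally nilpotent derivations on the coordinates -/

section Structure

variable {K : Type*} [Field K] [CharZero K] [IsAlgClosed K] {m p q : ℕ} {a : Fin m → ℕ}
  {b : Fin p → ℕ} {c : Fin q → ℕ} {D : Derivation K (CoordRing K a b c) (CoordRing K a b c)}
  (hp : 1 ≤ p) (ha : ∀ i, 2 ≤ a i) (hb : ∀ j, 2 ≤ b j) (hc : ∀ k, 2 ≤ c k)
  (hH : ¬ (((∀ j, Even (b j)) ∧ ∃ j, b j = 2) ∧ ((∀ k, Even (c k)) ∧ ∃ k, c k = 2)))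
  (hD : IsLocallyNilpotent D)

include hp ha hb hc hH hD in
-- A highest component of degree above -a_l sends x to positive degree, hence to a multiple of x; so
-- it kills x, and rigidity makes it zero.
theorem homComp_yWeight_eq_zero (l : Fin m) {e : ℤ} (he : -a l < e) :
    homComp (quotientPiece (yWeight a l) (trinomial K a b c)) D e = 0 := by
  by_cases hD0 : D = 0
  · refine derivation_ext fun v => ?_
    rw [homComp_of_mem (D := D) e (coordClass_mem_piece (yWeight a l) v), hD0]
    exact map_zero _
  obtain ⟨u, hu0, hu⟩ := exists_top_homComp (𝒜 := quotientPiece (yWeight a l) (trinomial K a b c))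
    (coordClass K a b c) (yWeight a l) (coordClass_mem_piece _) (adjoin_coordClass K a b c) hD0
  refine hu e (lt_of_le_of_lt ?_ he)
  by_contra! hlt
  have hLN := isLocallyNilpotent_homComp hD hu
  refine hu0 (eq_zero_of_apply_xIdx ha hb hc hH hLN (hLN.apply_eq_zero_of_dvd_apply ?_) hp)
  refine xIdx_dvd_of_mem ?_ (homComp_mem (D := D) u (coordClass_mem_piece (yWeight a l) xIdx))
  change 0 < (a l : ℤ) + u
  omega

include hp ha hb hc hH hD in
theorem apply_yIdx_eq_zero (l : Fin m) : D (coordClass K a b c (yIdx l)) = 0 := by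
  refine hD.apply_eq_zero_of_dvd_apply ?_
  rw [← pow_one (coordClass K a b c (yIdx l))]
  refine YOrderGE.dvd fun h hh => ?_
  rw [pow_one, proj_apply_of_mem (D := D) (coordClass_mem_piece (yWeight a l) (yIdx l)),
    homComp_yWeight_eq_zero hp ha hb hc hH hD l]
  · rfl
  · have := ha l
    have h1 : yWeight (p := p) (q := q) a l (yIdx l) = -1 := by simp [yWeight, mkPoint]
    rw [h1]
    omega

include hp ha hb hc hH hD in
theorem prod_dvd_apply {v : Coord m p q} (hv : ∀ l, yWeight a l v = 0) :
    ∏ i, coordClass K a b c (yIdx i) ^ a i ∣ D (coordClass K a b c v) := by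
  refine prod_yIdx_pow_dvd fun l h hh => ?_
  rw [proj_apply_of_mem (D := D) (coordClass_mem_piece (yWeight a l) v),
    homComp_yWeight_eq_zero hp ha hb hc hH hD l]
  · rfl
  · rwa [hv, sub_zero]

include hp ha hb hc hH hD in
theorem evalPoint_apply_eq_zero {α : Coord m p q → K} (hα : α ∈ hypersurface K a b c)
    {l : Fin m} (hl : α (yIdx l) = 0) {v : Coord m p q} (hv : ∀ l, yWeight a l v = 0) :
    evalPoint hα (D (coordClass K a b c v)) = 0 := by
  obtain ⟨k, hk⟩ := prod_dvd_apply hp ha hb hc hH hD hv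
  rw [hk, map_mul, map_prod, Finset.prod_eq_zero (Finset.mem_univ l), zero_mul]
  rw [map_pow, evalPoint_coordClass, hl, zero_pow]
  have := ha l
  omega

omit [CharZero K] [IsAlgClosed K] in
-- Besides Y, one factor f_i survives differentiation because its exponent is at least 2.
theorem exists_apply_prod_eq {A : Type*} [CommRing A] [Algebra K A] {D : Derivation K A A} {n : ℕ}
    {f : Fin n → A} {e : Fin n → ℕ} {Y : A} (h : ∀ i, Y ∣ D (f i)) {i : Fin n} (he : 2 ≤ e i) :
    ∃ r, D (∏ i, f i ^ e i) = Y * (f i * r) := by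
  have hprod : ∀ s : Finset (Fin n), Y ∣ D (∏ i ∈ s, f i ^ e i) := by
    intro s
    refine Finset.prod_induction _ (fun g => Y ∣ D g) (fun g g' hg hg' => ?_) (by simp)
      fun i _ => ?_
    · rw [D.leibniz]
      exact dvd_add (hg'.mul_left _) (hg.mul_left _)
    · rw [D.leibniz_pow, nsmul_eq_mul]
      exact ((h i).mul_left _).mul_left _
  obtain ⟨t, ht⟩ := h i
  obtain ⟨t', ht'⟩ := hprod (Finset.univ.erase i)
  obtain ⟨k, hk⟩ : ∃ k, e i = k + 2 := ⟨e i - 2, by omega⟩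
  refine ⟨(k + 2) * f i ^ k * t * (∏ i ∈ Finset.univ.erase i, f i ^ e i) + f i ^ (k + 1) * t', ?_⟩
  rw [← Finset.mul_prod_erase _ _ (Finset.mem_univ i), D.leibniz, ht', D.leibniz_pow, ht, hk]
  simp only [smul_eq_mul, nsmul_eq_mul, show k + 2 - 1 = k + 1 by omega]
  push_cast
  ring

include hp ha hb hc hH hD in
theorem evalPoint_apply_xIdx_eq_zero {α : Coord m p q → K} (hα : α ∈ hypersurface K a b c)
    {j : Fin p} (hj : α (zIdx j) = 0) {k : Fin q} (hk : α (sIdx k) = 0) :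
    evalPoint hα (D (coordClass K a b c xIdx)) = 0 := by
  set Y := ∏ i, coordClass K a b c (yIdx i) ^ a i with hY
  obtain ⟨r, hr⟩ := exists_apply_prod_eq (D := D) (f := fun j => coordClass K a b c (zIdx j))
    (fun j => prod_dvd_apply hp ha hb hc hH hD (v := zIdx j)
      (fun l => by simp [yWeight, mkPoint])) (hb j)
  obtain ⟨r', hr'⟩ := exists_apply_prod_eq (D := D) (f := fun k => coordClass K a b c (sIdx k))
    (fun k => prod_dvd_apply hp ha hb hc hH hD (v := sIdx k)
      (fun l => by simp [yWeight, mkPoint])) (hc k)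
  have hDY : D Y = 0 := by
    refine Finset.prod_induction _ (fun f => D f = 0) (fun f g hf hg => ?_) (by simp)
      fun i _ => ?_
    · rw [D.leibniz, hf, hg]
      simp
    · rw [D.leibniz_pow, apply_yIdx_eq_zero hp ha hb hc hH hD]
      simp
  have hrel := congrArg D (coordClass_relation K a b c)
  rw [map_zero, map_add, map_add, D.leibniz, ← hY, hDY, hr, hr'] at hrel
  have hY0 : Y ≠ 0 := prod_coordClass_ne_zero _ _
  -- D kills Y, so Y divides every term of the differentiated relation and can be cancelled.
  have hDx : D (coordClass K a b c xIdx) =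
      -(coordClass K a b c (zIdx j) * r + coordClass K a b c (sIdx k) * r') := by
    apply mul_left_cancel₀ hY0
    simp only [smul_eq_mul, mul_zero, zero_add] at hrel
    linear_combination hrel
  rw [hDx, map_neg, map_add, map_mul, map_mul, evalPoint_coordClass, evalPoint_coordClass, hj, hk]
  simp

end Structure

/-! ### From additive group actions to derivations -/

section Actions

variable {K : Type*} [Field K] {σ : Type*}

/-- The polynomials defining a regular action, as polynomials in the time variable. -/
noncomputable def timePoly (P : σ → MvPolynomial (Option σ) K) (i : σ) :
    Polynomial (MvPolynomial σ K) :=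
  aeval (fun o : Option σ => o.elim Polynomial.X fun j => Polynomial.C (X j)) (P i)

/-- The orbit of a point under a regular action, as a polynomial curve. -/
noncomputable def orbitCurve (P : σ → MvPolynomial (Option σ) K) (v : σ → K) (i : σ) :
    Polynomial K :=
  (timePoly P i).map (eval v)

theorem eval_orbitCurve (P : σ → MvPolynomial (Option σ) K) (v : σ → K) (i : σ) (t : K) :
    (orbitCurve P v i).eval t = eval (fun o : Option σ => o.elim t v) (P i) := by
  rw [orbitCurve, timePoly]
  induction P i using MvPolynomial.induction_on with
  | C r => simp [algHom_C, Polynomial.algebraMap_apply]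
  | add f g hf hg => simp only [map_add, Polynomial.map_add, Polynomial.eval_add, hf, hg]
  | mul_X f o hf =>
    rw [map_mul, Polynomial.map_mul, Polynomial.eval_mul, hf, map_mul, aeval_X, eval_X]
    rcases o with _ | j <;> simp

theorem aeval_orbitCurve (P : σ → MvPolynomial (Option σ) K) (v : σ → K)
    (f : MvPolynomial σ K) :
    aeval (orbitCurve P v) f = (aeval (timePoly P) f).map (eval v) := by
  induction f using MvPolynomial.induction_on with
  | C r => simp [algHom_C, Polynomial.algebraMap_apply]
  | add f g hf hg => simp only [map_add, Polynomial.map_add, hf, hg]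
  | mul_X f i hf =>
    rw [map_mul, hf, map_mul, Polynomial.map_mul, aeval_X, aeval_X]
    rfl

theorem eval_aeval_orbitCurve (P : σ → MvPolynomial (Option σ) K) (v : σ → K) (t : K)
    (f : MvPolynomial σ K) :
    (aeval (orbitCurve P v) f).eval t = eval (fun i => (orbitCurve P v i).eval t) f := by
  induction f using MvPolynomial.induction_on with
  | C r => simp [algHom_C]
  | add f g hf hg => simp only [map_add, Polynomial.eval_add, hf, hg]
  | mul_X f i hf => simp only [map_mul, Polynomial.eval_mul, hf, aeval_X, eval_X]

/-- The velocity vector field of a regular action, as a derivation. -/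
noncomputable def velocity (P : σ → MvPolynomial (Option σ) K) :
    Derivation K (MvPolynomial σ K) (MvPolynomial σ K) :=
  mkDerivation K fun i => (timePoly P i).coeff 1

theorem eval_velocity {P : σ → MvPolynomial (Option σ) K} {v : σ → K}
    (h : ∀ i, (orbitCurve P v i).eval 0 = v i) (f : MvPolynomial σ K) :
    eval v (velocity P f) = (aeval (orbitCurve P v) f).derivative.eval 0 := by
  induction f using MvPolynomial.induction_on with
  | C r =>
    rw [← algebraMap_eq, Derivation.map_algebraMap, AlgHom.commutes]
    simp
  | add f g hf hg => simp only [map_add, Polynomial.eval_add, hf, hg]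
  | mul_X f i hf =>
    have h1 : eval v f = (aeval (orbitCurve P v) f).eval 0 := by
      rw [eval_aeval_orbitCurve]
      simp only [h]
    have h2 : eval v (velocity P (X i)) = (orbitCurve P v i).derivative.eval 0 := by
      rw [velocity, mkDerivation_X, ← Polynomial.coeff_zero_eq_eval_zero,
        Polynomial.coeff_derivative, orbitCurve, Polynomial.coeff_map]
      simp
    rw [Derivation.leibniz, map_add, smul_eq_mul, smul_eq_mul, map_mul, map_mul, map_mul, h2, hf,
      h1, eval_X, aeval_X, Polynomial.derivative_mul, Polynomial.eval_add, Polynomial.eval_mul,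
      Polynomial.eval_mul, h]
    ring

variable [Infinite K] {V : Set (σ → K)} {ρ : Multiplicative K →* Equiv.Perm V}
  {P : σ → MvPolynomial (Option σ) K}
  (hP : ∀ (t : K) (v : V) (i : σ), (ρ (Multiplicative.ofAdd t) v : σ → K) i =
    eval (fun o : Option σ => o.elim t (v : σ → K)) (P i))

include hP

omit [Infinite K] in
theorem eval_orbitCurve_eq (v : V) (t : K) (i : σ) :
    (orbitCurve P v i).eval t = (ρ (Multiplicative.ofAdd t) v : σ → K) i := by
  rw [eval_orbitCurve, hP]

omit [Infinite K] in
theorem eval_orbitCurve_zero (v : V) (i : σ) : (orbitCurve P v i).eval 0 = (v : σ → K) i := by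
  rw [eval_orbitCurve_eq hP, ofAdd_zero, map_one]
  rfl

/-- The group law turns moving the starting point into a translation of time, so facts at time 0
hold at all times. -/
theorem aeval_orbitCurve_comp (v : V) (t : K) (f : MvPolynomial σ K) :
    aeval (orbitCurve P (ρ (Multiplicative.ofAdd t) v : V)) f =
      (aeval (orbitCurve P v) f).comp (Polynomial.X + Polynomial.C t) := by
  apply Polynomial.funext
  intro s
  rw [Polynomial.eval_comp, eval_aeval_orbitCurve, eval_aeval_orbitCurve]
  simp only [eval_orbitCurve_eq hP, Polynomial.eval_add, Polynomial.eval_X, Polynomial.eval_C]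
  rw [ofAdd_add, map_mul]
  rfl

theorem eval_velocity_orbit (v : V) (t : K) (f : MvPolynomial σ K) :
    eval (ρ (Multiplicative.ofAdd t) v : σ → K) (velocity P f) =
      (aeval (orbitCurve P v) f).derivative.eval t := by
  rw [eval_velocity (eval_orbitCurve_zero hP _), aeval_orbitCurve_comp hP,
    Polynomial.derivative_comp]
  simp

theorem aeval_orbitCurve_velocity (v : V) (f : MvPolynomial σ K) :
    aeval (orbitCurve P v) (velocity P f) = (aeval (orbitCurve P v) f).derivative := by
  apply Polynomial.funext
  intro t
  rw [← eval_velocity_orbit hP, eval_aeval_orbitCurve]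
  simp only [eval_orbitCurve_eq hP]

/-- Along orbits the velocity field is d/dt, and f restricted to an orbit is a polynomial in t whose
degree is bounded independently of the point. The conclusion holds only on V, so nilpotency appears
after passing to the coordinate ring. -/
theorem exists_iterate_velocity (f : MvPolynomial σ K) :
    ∃ n, ∀ v : V, eval (v : σ → K) ((velocity P)^[n] f) = 0 := by
  refine ⟨(aeval (timePoly P) f).natDegree + 1, fun v => ?_⟩
  have key : ∀ n, aeval (orbitCurve P v) ((velocity P)^[n] f) =
      Polynomial.derivative^[n] (aeval (orbitCurve P v) f) := by
    intro n
    induction n with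
    | zero => rfl
    | succ n ih =>
      rw [Function.iterate_succ_apply', aeval_orbitCurve_velocity hP, ih,
        Function.iterate_succ_apply']
  have h0 := eval_aeval_orbitCurve P v 0
    ((velocity P)^[(aeval (timePoly P) f).natDegree + 1] f)
  rw [key, Polynomial.iterate_derivative_eq_zero, Polynomial.eval_zero] at h0
  · simp only [eval_orbitCurve_zero hP] at h0
    exact h0.symm
  · rw [aeval_orbitCurve]
    exact Nat.lt_succ_of_le Polynomial.natDegree_map_le

theorem velocity_mem_vanishingIdeal {f : MvPolynomial σ K} (hf : f ∈ vanishingIdeal K V) :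
    velocity P f ∈ vanishingIdeal K V := by
  rw [mem_vanishingIdeal_iff] at hf ⊢
  intro v hv
  have h1 : aeval (orbitCurve P v) f = 0 := by
    apply Polynomial.funext
    intro t
    rw [eval_aeval_orbitCurve, Polynomial.eval_zero]
    simp only [eval_orbitCurve_eq hP (⟨v, hv⟩ : V)]
    exact hf _ (Subtype.coe_prop _)
  have h2 := eval_velocity (eval_orbitCurve_zero hP (⟨v, hv⟩ : V)) f
  rw [h1] at h2
  simpa using h2

end Actions

/-! ### Invariants of special automorphisms -/

section HypersurfaceActions

variable {K : Type*} [Field K] [CharZero K] [IsAlgClosed K] {m p q : ℕ} {a : Fin m → ℕ}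
  {b : Fin p → ℕ} {c : Fin q → ℕ}

/-- A regular action of the additive group is governed by a locally nilpotent derivation. -/
theorem exists_derivation_of_isRegularGaAction
    {ρ : Multiplicative K →* Equiv.Perm (hypersurface K a b c)}
    (hρ : IsRegularGaAction (hypersurface K a b c) ρ) :
    ∃ D : Derivation K (CoordRing K a b c) (CoordRing K a b c), IsLocallyNilpotent D ∧
      ∀ (v : hypersurface K a b c) (i : Coord m p q), ∃ h : Polynomial K,
        (∀ t, h.eval t = (ρ (Multiplicative.ofAdd t) v : Coord m p q → K) i) ∧
        ∀ t, h.derivative.eval t = evalPoint (ρ (Multiplicative.ofAdd t) v).2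
          (D (coordClass K a b c i)) := by
  obtain ⟨P, hP⟩ := hρ
  -- The velocity field preserves the vanishing ideal of X, which the trinomial generates by the
  -- Nullstellensatz.
  have hmk : ∀ f, Ideal.Quotient.mkₐ K (Ideal.span {trinomial K a b c}) f = 0 →
      Ideal.Quotient.mkₐ K (Ideal.span {trinomial K a b c}) (velocity P f) = 0 := by
    intro f hf
    have hf' := Ideal.Quotient.eq_zero_iff_mem.1 hf
    refine Ideal.Quotient.eq_zero_iff_mem.2 ?_
    rw [← vanishingIdeal_hypersurface] at hf' ⊢
    exact velocity_mem_vanishingIdeal hP hf'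
  have hsurj : Function.Surjective (Ideal.Quotient.mkₐ K (Ideal.span {trinomial K a b c})) :=
    Ideal.Quotient.mkₐ_surjective K _
  have hDmk : ∀ f, Derivation.liftOfSurjective hsurj hmk
      (Ideal.Quotient.mk (Ideal.span {trinomial K a b c}) f) =
      Ideal.Quotient.mk (Ideal.span {trinomial K a b c}) (velocity P f) :=
    Derivation.liftOfSurjective_apply hsurj hmk
  refine ⟨Derivation.liftOfSurjective hsurj hmk, ?_, ?_⟩
  · intro f
    obtain ⟨φ, rfl⟩ := Ideal.Quotient.mk_surjective f
    obtain ⟨n, hn⟩ := exists_iterate_velocity hP φ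
    refine ⟨n, ?_⟩
    have key : ∀ n, (Derivation.liftOfSurjective hsurj hmk)^[n]
        (Ideal.Quotient.mk (Ideal.span {trinomial K a b c}) φ) =
        Ideal.Quotient.mk (Ideal.span {trinomial K a b c}) ((velocity P)^[n] φ) := by
      intro n
      induction n with
      | zero => rfl
      | succ n ih => rw [Function.iterate_succ_apply', ih, hDmk, Function.iterate_succ_apply']
    rw [key]
    refine Ideal.Quotient.eq_zero_iff_mem.2 ?_
    rw [← vanishingIdeal_hypersurface, mem_vanishingIdeal_iff]
    exact fun v hv => hn ⟨v, hv⟩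
  · intro v i
    refine ⟨orbitCurve P v i, fun t => eval_orbitCurve_eq hP v t i, fun t => ?_⟩
    rw [coordClass, hDmk, evalPoint_mk, eval_velocity_orbit hP, aeval_X]

theorem coord_eq_of_evalPoint_eq_zero
    {ρ : Multiplicative K →* Equiv.Perm (hypersurface K a b c)}
    {D : Derivation K (CoordRing K a b c) (CoordRing K a b c)} {v : hypersurface K a b c}
    {i : Coord m p q} {h : Polynomial K}
    (hρ : ∀ t, h.eval t = (ρ (Multiplicative.ofAdd t) v : Coord m p q → K) i)
    (hd : ∀ t, h.derivative.eval t = evalPoint (ρ (Multiplicative.ofAdd t) v).2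
      (D (coordClass K a b c i)))
    (h0 : ∀ t, evalPoint (ρ (Multiplicative.ofAdd t) v).2 (D (coordClass K a b c i)) = 0) (t : K) :
    (ρ (Multiplicative.ofAdd t) v : Coord m p q → K) i = (v : Coord m p q → K) i := by
  have hder : h.derivative = 0 := Polynomial.funext fun t => by rw [hd, h0, Polynomial.eval_zero]
  have hC := Polynomial.eq_C_of_derivative_eq_zero hder
  have h1 := hρ 0
  rw [ofAdd_zero, map_one, Equiv.Perm.one_apply] at h1
  rw [← hρ t, ← h1, hC]
  simp

/-- The relation between a point and its image that all special automorphisms respect. -/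
def IsSautInvariant (g : Equiv.Perm (hypersurface K a b c)) : Prop :=
  ∀ v : hypersurface K a b c,
    (∀ i, (g v : Coord m p q → K) (yIdx i) = (v : Coord m p q → K) (yIdx i)) ∧
    ((∃ l, (v : Coord m p q → K) (yIdx l) = 0) →
      (∀ j, (g v : Coord m p q → K) (zIdx j) = (v : Coord m p q → K) (zIdx j)) ∧
      (∀ k, (g v : Coord m p q → K) (sIdx k) = (v : Coord m p q → K) (sIdx k)) ∧
      ((∃ j, (v : Coord m p q → K) (zIdx j) = 0) → (∃ k, (v : Coord m p q → K) (sIdx k) = 0) →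
        g v = v))

variable (hp : 1 ≤ p) (ha : ∀ i, 2 ≤ a i) (hb : ∀ j, 2 ≤ b j) (hc : ∀ k, 2 ≤ c k)
  (hH : ¬ (((∀ j, Even (b j)) ∧ ∃ j, b j = 2) ∧ ((∀ k, Even (c k)) ∧ ∃ k, c k = 2)))

include hp ha hb hc hH in
-- The order matters: y is constant, so the condition y_l = 0 persists along the orbit, and D z, D s
-- vanish at all times. Then z and s are constant too, and only now does D x vanish along the whole
-- orbit.
theorem isSautInvariant_of_isRegularGaAction
    {ρ : Multiplicative K →* Equiv.Perm (hypersurface K a b c)}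
    (hρ : IsRegularGaAction (hypersurface K a b c) ρ) (t : K) :
    IsSautInvariant (ρ (Multiplicative.ofAdd t)) := by
  obtain ⟨D, hD, hcurve⟩ := exists_derivation_of_isRegularGaAction hρ
  intro v
  choose h hh hhd using hcurve v
  have hconst := fun (i : Coord m p q) => coord_eq_of_evalPoint_eq_zero (hh i) (hhd i)
  have hy : ∀ i t, (ρ (Multiplicative.ofAdd t) v : Coord m p q → K) (yIdx i) =
      (v : Coord m p q → K) (yIdx i) := fun i =>
    hconst (yIdx i) fun t => by rw [apply_yIdx_eq_zero hp ha hb hc hH hD, map_zero]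
  refine ⟨fun i => hy i t, ?_⟩
  rintro ⟨l, hl⟩
  have hz : ∀ j t, (ρ (Multiplicative.ofAdd t) v : Coord m p q → K) (zIdx j) =
      (v : Coord m p q → K) (zIdx j) := fun j =>
    hconst (zIdx j) fun t => evalPoint_apply_eq_zero hp ha hb hc hH hD _ ((hy l t).trans hl)
      fun l => by simp [yWeight, mkPoint]
  have hs : ∀ k t, (ρ (Multiplicative.ofAdd t) v : Coord m p q → K) (sIdx k) =
      (v : Coord m p q → K) (sIdx k) := fun k =>
    hconst (sIdx k) fun t => evalPoint_apply_eq_zero hp ha hb hc hH hD _ ((hy l t).trans hl)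
      fun l => by simp [yWeight, mkPoint]
  refine ⟨fun j => hz j t, fun k => hs k t, ?_⟩
  rintro ⟨j, hj⟩ ⟨k, hk⟩
  have hx := hconst xIdx fun t => evalPoint_apply_xIdx_eq_zero hp ha hb hc hH hD _
    ((hz j t).trans hj) ((hs k t).trans hk)
  apply Subtype.ext
  funext w
  rcases w with _ | i | j | k
  · exact hx t
  · exact hy i t
  · exact hz j t
  · exact hs k t

include hp ha hb hc hH in
theorem isSautInvariant_of_mem_SAut {g : Equiv.Perm (hypersurface K a b c)}
    (hg : g ∈ SAut (hypersurface K a b c)) : IsSautInvariant g := by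
  let S : Subgroup (Equiv.Perm (hypersurface K a b c)) :=
    { carrier := {g | IsSautInvariant g}
      one_mem' := fun v => ⟨fun _ => rfl, fun _ => ⟨fun _ => rfl, fun _ => rfl, fun _ _ => rfl⟩⟩
      mul_mem' := by
        intro g g' hg hg' v
        obtain ⟨h1, h2⟩ := hg' v
        obtain ⟨h3, h4⟩ := hg (g' v)
        refine ⟨fun i => (h3 i).trans (h1 i), fun hl => ?_⟩
        obtain ⟨h5, h6, h7⟩ := h2 hl
        obtain ⟨l, hl⟩ := hl
        obtain ⟨h8, h9, h10⟩ := h4 ⟨l, (h1 l).trans hl⟩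
        refine ⟨fun j => (h8 j).trans (h5 j), fun k => (h9 k).trans (h6 k), ?_⟩
        rintro ⟨j, hj⟩ ⟨k, hk⟩
        exact (h10 ⟨j, (h5 j).trans hj⟩ ⟨k, (h6 k).trans hk⟩).trans (h7 ⟨j, hj⟩ ⟨k, hk⟩)
      inv_mem' := by
        intro g hg v
        have hv : g (g⁻¹ v) = v := g.apply_symm_apply v
        obtain ⟨h1, h2⟩ := hg (g⁻¹ v)
        rw [hv] at h1 h2
        refine ⟨fun i => (h1 i).symm, fun hl => ?_⟩
        obtain ⟨l, hl⟩ := hl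
        obtain ⟨h3, h4, h5⟩ := h2 ⟨l, (h1 l).symm.trans hl⟩
        refine ⟨fun j => (h3 j).symm, fun k => (h4 k).symm, ?_⟩
        rintro ⟨j, hj⟩ ⟨k, hk⟩
        exact (h5 ⟨j, (h3 j).symm.trans hj⟩ ⟨k, (h4 k).symm.trans hk⟩).symm }
  have hle : SAut (hypersurface K a b c) ≤ S := by
    refine sSup_le ?_
    rintro _ ⟨ρ, hρ, rfl⟩ _ ⟨t, rfl⟩
    exact isSautInvariant_of_isRegularGaAction hp ha hb hc hH hρ t.toAdd
  exact hle hg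

end HypersurfaceActions

/-! ### Divided differences of polynomials -/

section DividedDifference

variable {K : Type*} [Field K] {σ τ : Type*}

theorem eval_bind₁' (f : σ → MvPolynomial τ K) (v : τ → K) (φ : MvPolynomial σ K) :
    eval v (bind₁ f φ) = eval (fun i => eval v (f i)) φ := by
  have := aeval_bind₁ (S := K) v f φ
  simp only [aeval_eq_eval] at this
  exact this

/-- The divided difference of a polynomial in the direction of a fixed vector. -/
theorem exists_dividedDifference (e : σ → K) (G : MvPolynomial σ K) :
    ∃ Θ : MvPolynomial (Option σ) K,
      (∀ (T : K) (u : σ → K), eval (u + T • e) G =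
        eval u G + T * eval (fun o : Option σ => o.elim T u) Θ) ∧
      ∀ u : σ → K, eval (fun o : Option σ => o.elim 0 u) Θ =
        eval u (mkDerivation K (fun i => (C (e i) : MvPolynomial σ K)) G) := by
  induction G using MvPolynomial.induction_on with
  | C r =>
    refine ⟨0, fun T u => by simp, fun u => ?_⟩
    rw [← algebraMap_eq, Derivation.map_algebraMap, map_zero, map_zero]
  | add f g hf hg =>
    obtain ⟨Θ₁, h₁, h₁'⟩ := hf
    obtain ⟨Θ₂, h₂, h₂'⟩ := hg
    refine ⟨Θ₁ + Θ₂, fun T u => ?_, fun u => ?_⟩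
    · rw [map_add, map_add, map_add, h₁, h₂]
      ring
    · rw [map_add, map_add, map_add, h₁', h₂']
  | mul_X f i hf =>
    obtain ⟨Θ, h, h'⟩ := hf
    refine ⟨Θ * (X (some i) + C (e i) * X none) + rename some f * C (e i), fun T u => ?_,
      fun u => ?_⟩
    · have : ((fun o : Option σ => o.elim T u) ∘ some) = u := rfl
      simp only [map_mul, map_add, eval_X, eval_C, eval_rename, this, h, Pi.add_apply,
        Pi.smul_apply, smul_eq_mul, Option.elim_some, Option.elim_none]
      ring
    · have : ((fun o : Option σ => o.elim 0 u) ∘ some) = u := rfl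
      simp only [map_mul, map_add, eval_X, eval_C, eval_rename, this, h', Derivation.leibniz,
        mkDerivation_X, smul_eq_mul, Option.elim_some, Option.elim_none]
      ring

theorem pderiv_eq_mkDerivation [DecidableEq σ] (i : σ) :
    pderiv (R := K) i = mkDerivation K (fun j => (C (Pi.single (M := fun _ => K) i 1 j) :
      MvPolynomial σ K)) := by
  apply MvPolynomial.derivation_ext
  intro j
  rw [mkDerivation_X, pderiv_X]
  by_cases h : j = i
  · subst h; simp
  · simp [h]

/-- Multiplying by the variable avoids the exponent b j - 1 and gives back the whole monomial. -/
theorem eval_pderiv_prod_X_pow [DecidableEq σ] {n : ℕ} {f : Fin n → σ}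
    (hf : Function.Injective f) (b : Fin n → ℕ) (j : Fin n) (u : σ → K) :
    u (f j) * eval u (pderiv (f j) (∏ i, X (f i) ^ b i)) = b j * ∏ i, u (f i) ^ b i := by
  have h0 : pderiv (R := K) (f j) (∏ i ∈ Finset.univ.erase j, X (f i) ^ b i) = 0 := by
    refine pderiv_eq_zero_of_notMem_vars fun h => ?_
    obtain ⟨i, hi, h⟩ := Finset.mem_biUnion.1 (vars_prod _ h)
    have := vars_pow _ _ h
    rw [vars_X, Finset.mem_singleton] at this
    exact Finset.ne_of_mem_erase hi (hf this.symm)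
  rw [← Finset.mul_prod_erase _ _ (Finset.mem_univ j),
    ← Finset.mul_prod_erase _ _ (Finset.mem_univ j), Derivation.leibniz, h0, smul_zero, zero_add,
    Derivation.leibniz_pow, pderiv_X_self]
  simp only [smul_eq_mul, map_mul, map_prod, map_pow, eval_X, nsmul_eq_mul, map_natCast, mul_one]
  rcases Nat.eq_zero_or_pos (b j) with h | h
  · simp [h]
  · obtain ⟨k, hk⟩ := Nat.exists_eq_add_of_le' h
    rw [hk, Nat.add_sub_cancel, pow_succ]
    ring

end DividedDifference

/-! ### Explicit additive group actions -/

section Shift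

variable {K : Type*} [Field K] {m p q : ℕ} (a : Fin m → ℕ) (b : Fin p → ℕ) (c : Fin q → ℕ)

/-- The sum of the last two monomials of the trinomial. -/
noncomputable def tailPoly (K : Type*) [Field K] {p q : ℕ} (b : Fin p → ℕ) (c : Fin q → ℕ) :
    MvPolynomial (Fin p ⊕ Fin q) K :=
  ∏ j, X (Sum.inl j) ^ b j + ∏ k, X (Sum.inr k) ^ c k

/-- The coordinates `z` and `s` of a point. -/
def tail {K : Type*} {m p q : ℕ} (v : Coord m p q → K) : Fin p ⊕ Fin q → K :=
  fun w => v (Sum.inr (Sum.inr w))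

/-- The monomial in the coordinates `y`. -/
def yProd {K : Type*} [Field K] {m p q : ℕ} (a : Fin m → ℕ) (v : Coord m p q → K) : K :=
  ∏ i, v (yIdx i) ^ a i

variable {a b c}

theorem mem_hypersurface_iff_tail {v : Coord m p q → K} : v ∈ hypersurface K a b c ↔
    v xIdx * yProd a v + eval (tail v) (tailPoly K b c) = 0 := by
  rw [mem_hypersurface, tailPoly, yProd, add_assoc]
  simp [tail]

/-- The formula for the one-parameter group moving the coordinates `z`, `s` in the direction
`e`. -/
noncomputable def shiftFun (a : Fin m → ℕ) (e : Fin p ⊕ Fin q → K)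
    (Θ : MvPolynomial (Option (Fin p ⊕ Fin q)) K) (t : K) (v : Coord m p q → K) :
    Coord m p q → K :=
  Sum.elim
    (fun _ => v xIdx - t * eval (fun o : Option (Fin p ⊕ Fin q) =>
      o.elim (t * yProd a v) (tail v)) Θ)
    (Sum.elim (fun i => v (yIdx i)) (tail v + (t * yProd a v) • e))

theorem yProd_shiftFun (e : Fin p ⊕ Fin q → K) (Θ : MvPolynomial (Option (Fin p ⊕ Fin q)) K)
    (t : K) (v : Coord m p q → K) : yProd a (shiftFun a e Θ t v) = yProd a v := rfl

theorem tail_shiftFun (e : Fin p ⊕ Fin q → K) (Θ : MvPolynomial (Option (Fin p ⊕ Fin q)) K)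
    (t : K) (v : Coord m p q → K) :
    tail (shiftFun a e Θ t v) = tail v + (t * yProd a v) • e := rfl

theorem shiftFun_zero (e : Fin p ⊕ Fin q → K) (Θ : MvPolynomial (Option (Fin p ⊕ Fin q)) K)
    (v : Coord m p q → K) : shiftFun a e Θ 0 v = v := by
  funext w
  rcases w with _ | i | w
  · simp [shiftFun]
  · rfl
  · simp [shiftFun, tail]

variable {e : Fin p ⊕ Fin q → K} {Θ : MvPolynomial (Option (Fin p ⊕ Fin q)) K}
  (hΘ : ∀ (T : K) (u : Fin p ⊕ Fin q → K), eval (u + T • e) (tailPoly K b c) =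
    eval u (tailPoly K b c) + T * eval (fun o : Option (Fin p ⊕ Fin q) => o.elim T u) Θ)

include hΘ

/-- The term xY loses tYΘ, which is exactly what Z + S gains. -/
theorem shiftFun_mem (t : K) {v : Coord m p q → K} (hv : v ∈ hypersurface K a b c) :
    shiftFun a e Θ t v ∈ hypersurface K a b c := by
  rw [mem_hypersurface_iff_tail] at hv ⊢
  rw [yProd_shiftFun, tail_shiftFun, hΘ, ← hv]
  simp only [shiftFun, Sum.elim_inl]
  ring

theorem shiftFun_add (t t' : K) (v : Coord m p q → K) :
    shiftFun a e Θ (t + t') v = shiftFun a e Θ t (shiftFun a e Θ t' v) := by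
  have htail : tail (shiftFun a e Θ (t + t') v) =
      tail (shiftFun a e Θ t (shiftFun a e Θ t' v)) := by
    rw [tail_shiftFun, tail_shiftFun, tail_shiftFun, yProd_shiftFun, add_assoc, ← add_smul]
    congr 2
    ring
  funext w
  rcases w with _ | i | w
  · change v xIdx - (t + t') * _ = v xIdx - t' * _ - t * _
    rw [yProd_shiftFun, tail_shiftFun]
    -- If Y = 0, every value of Θ is taken at the same point and the displacement of x is linear in
    -- t. Otherwise the claim times Y is the additivity of the increments of Z + S.
    by_cases hY : yProd a v = 0
    · rw [hY]
      simp only [mul_zero, zero_smul, add_zero]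
      ring
    · apply mul_right_cancel₀ hY
      have h1 := hΘ ((t + t') * yProd a v) (tail v)
      have h2 := hΘ (t' * yProd a v) (tail v)
      have h3 := hΘ (t * yProd a v) (tail v + (t' * yProd a v) • e)
      have h4 : tail v + (t' * yProd a v) • e + (t * yProd a v) • e =
          tail v + ((t + t') * yProd a v) • e := by
        rw [add_assoc, ← add_smul]
        congr 2
        ring
      rw [h4, h2, h1] at h3
      linear_combination -h3
  · rfl
  · exact congrFun htail w

/-- The action of the additive group given by `shiftFun`. -/
noncomputable def shiftAction : Multiplicative K →* Equiv.Perm (hypersurface K a b c) :=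
  let _ : MulAction (Multiplicative K) (hypersurface K a b c) :=
    { smul := fun t v => ⟨shiftFun a e Θ t.toAdd v, shiftFun_mem hΘ _ v.2⟩
      one_smul := fun v => Subtype.ext (shiftFun_zero (a := a) e Θ v.1)
      mul_smul := fun t t' v => Subtype.ext (shiftFun_add hΘ t.toAdd t'.toAdd v.1) }
  MulAction.toPermHom _ _

theorem shiftAction_apply (t : K) (v : hypersurface K a b c) :
    (shiftAction hΘ (Multiplicative.ofAdd t) v : Coord m p q → K) = shiftFun a e Θ t v := rfl

theorem isRegularGaAction_shiftAction :
    IsRegularGaAction (hypersurface K a b c) (shiftAction hΘ) := by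
  let Y : MvPolynomial (Option (Coord m p q)) K := ∏ i, X (some (yIdx i)) ^ a i
  have hY : ∀ (t : K) (v : Coord m p q → K),
      eval (fun o : Option (Coord m p q) => o.elim t v) Y = yProd a v := by
    intro t v
    simp [Y, yProd]
  refine ⟨Sum.elim (fun _ => X (some xIdx) - X none * bind₁ (fun o : Option (Fin p ⊕ Fin q) =>
      o.elim (X none * Y) fun w => X (some (Sum.inr (Sum.inr w)))) Θ)
    (Sum.elim (fun i => X (some (yIdx i)))
      fun w => X (some (Sum.inr (Sum.inr w))) + X none * Y * C (e w)), ?_⟩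
  intro t v w
  rw [shiftAction_apply]
  rcases w with _ | i | w
  · simp only [shiftFun, Sum.elim_inl, map_sub, map_mul, eval_X, eval_bind₁', Option.elim_some,
      Option.elim_none]
    congr 4
    funext o
    rcases o with _ | w
    · simp [hY]
    · simp [tail]
  · simp [shiftFun]
  · simp [shiftFun, hY, tail]

theorem shiftAction_mem_SAut (t : K) :
    shiftAction hΘ (Multiplicative.ofAdd t) ∈ SAut (hypersurface K a b c) := by
  have hle : (shiftAction hΘ).range ≤ SAut (hypersurface K a b c) :=
    le_sSup ⟨shiftAction hΘ, isRegularGaAction_shiftAction hΘ, rfl⟩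
  exact hle (MonoidHom.mem_range.2 ⟨_, rfl⟩)

omit hΘ in
/-- Points with the same nonzero coordinates `y` lie in one orbit. -/
theorem exists_mem_SAut_of_y_eq {α β : hypersurface K a b c}
    (h0 : ∀ i, (α : Coord m p q → K) (yIdx i) ≠ 0)
    (h : ∀ i, (β : Coord m p q → K) (yIdx i) = (α : Coord m p q → K) (yIdx i)) :
    ∃ g ∈ SAut (hypersurface K a b c), g α = β := by
  have hY : yProd a (α : Coord m p q → K) ≠ 0 :=
    Finset.prod_ne_zero_iff.2 fun i _ => pow_ne_zero _ (h0 i)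
  have hYβ : yProd a (β : Coord m p q → K) = yProd a (α : Coord m p q → K) := by
    simp only [yProd, h]
  -- The factor Y⁻¹ makes time 1 carry (z, s) of α to that of β; the equation of X then determines
  -- x.
  obtain ⟨Θ, hΘ, -⟩ := exists_dividedDifference
    ((yProd a (α : Coord m p q → K))⁻¹ • (tail (β : Coord m p q → K) - tail (α : Coord m p q → K)))
    (tailPoly K b c)
  refine ⟨_, shiftAction_mem_SAut hΘ 1, ?_⟩
  have htail : tail (shiftAction hΘ (Multiplicative.ofAdd 1) α : Coord m p q → K) =
      tail (β : Coord m p q → K) := by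
    rw [shiftAction_apply, tail_shiftFun, one_mul, smul_smul, mul_inv_cancel₀ hY, one_smul,
      add_sub_cancel]
  apply Subtype.ext
  funext w
  rcases w with ⟨⟩ | i | w
  · have h1 := mem_hypersurface_iff_tail.1 β.2
    have h2 := mem_hypersurface_iff_tail.1 (shiftAction hΘ (Multiplicative.ofAdd 1) α).2
    rw [htail, shiftAction_apply, yProd_shiftFun] at h2
    rw [hYβ] at h1
    apply mul_right_cancel₀ hY
    rw [shiftAction_apply]
    exact add_right_cancel (h2.trans h1.symm)
  · exact (h i).symm
  · exact congrFun htail w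

omit hΘ in
/-- Points that differ in the coordinate `x` only, where some `y` vanishes and no `z` vanishes, lie
in one orbit. -/
theorem exists_mem_SAut_of_tail_eq [CharZero K] (hp : 1 ≤ p) (hb : ∀ j, b j ≠ 0)
    {α β : hypersurface K a b c} (h0 : yProd a (α : Coord m p q → K) = 0)
    (hz : ∀ j, (α : Coord m p q → K) (zIdx j) ≠ 0)
    (h : ∀ w, (β : Coord m p q → K) (Sum.inr w) = (α : Coord m p q → K) (Sum.inr w)) :
    ∃ g ∈ SAut (hypersurface K a b c), g α = β := by
  classical
  obtain ⟨Θ, hΘ, hΘ'⟩ := exists_dividedDifference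
    (Pi.single (M := fun _ => K) (Sum.inl (⟨0, hp⟩ : Fin p) : Fin p ⊕ Fin q) 1) (tailPoly K b c)
  -- At T = 0 the divided difference is the partial derivative of Z by its first variable, nonzero
  -- since no z_j vanishes.
  have hne : eval (fun o : Option (Fin p ⊕ Fin q) => o.elim 0 (tail (α : Coord m p q → K))) Θ
      ≠ 0 := by
    rw [hΘ', ← pderiv_eq_mkDerivation, tailPoly, map_add, map_add,
      pderiv_eq_zero_of_notMem_vars (f := ∏ k : Fin q, X (Sum.inr k) ^ c k), map_zero, add_zero]
    · intro h
      have := eval_pderiv_prod_X_pow (K := K) (f := (Sum.inl : Fin p → Fin p ⊕ Fin q))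
        Sum.inl_injective b ⟨0, hp⟩ (tail (α : Coord m p q → K))
      rw [h, mul_zero] at this
      exact mul_ne_zero (Nat.cast_ne_zero.2 (hb _))
        (Finset.prod_ne_zero_iff.2 fun i _ => pow_ne_zero _ (hz i)) this.symm
    · intro h
      obtain ⟨i, hi, h⟩ := Finset.mem_biUnion.1 (vars_prod _ h)
      have := vars_pow _ _ h
      rw [vars_X, Finset.mem_singleton] at this
      exact Sum.inl_ne_inr this
  refine ⟨_, shiftAction_mem_SAut hΘ (((α : Coord m p q → K) xIdx - (β : Coord m p q → K) xIdx) /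
    eval (fun o : Option (Fin p ⊕ Fin q) => o.elim 0 (tail (α : Coord m p q → K))) Θ), ?_⟩
  apply Subtype.ext
  rw [shiftAction_apply]
  funext w
  rcases w with ⟨⟩ | i | w
  · simp only [shiftFun, Sum.elim_inl, h0, mul_zero, div_mul_cancel₀ _ hne]
    ring
  · exact (h _).symm
  · rw [h]
    simp [shiftFun, h0, tail]

end Shift

/-! ### Dimension of a hypersurface and the Jacobian criterion -/

section PolynomialDimension

variable {K : Type*} [Field K] {σ : Type*}

/-- Translation of the coordinates by a vector. -/
noncomputable def translateEquiv (β : σ → K) : MvPolynomial σ K ≃ₐ[K] MvPolynomial σ K :=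
  AlgEquiv.ofAlgHom (aeval fun i => X i + C (β i)) (aeval fun i => X i - C (β i))
    (by
      apply MvPolynomial.algHom_ext
      intro i
      simp [algHom_C])
    (by
      apply MvPolynomial.algHom_ext
      intro i
      simp [algHom_C])

theorem eval_translateEquiv (α β : σ → K) (f : MvPolynomial σ K) :
    eval α (translateEquiv β f) = eval (α + β) f := by
  change eval α (bind₁ _ f) = _
  rw [eval_bind₁']
  congr 2
  funext i
  simp

theorem comap_translateEquiv (α β : σ → K) :
    (vanishingIdeal K {α}).comap (translateEquiv β).toRingEquiv =
      vanishingIdeal K {α + β} := by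
  ext f
  rw [Ideal.mem_comap, mem_vanishingIdeal_singleton_iff, mem_vanishingIdeal_singleton_iff]
  simp only [aeval_eq_eval]
  change eval α (translateEquiv β f) = 0 ↔ eval (α + β) f = 0
  rw [eval_translateEquiv]

/-- Every maximal ideal belongs to a point, and translations permute the points transitively, so all
maximal ideals have the same height. -/
theorem height_vanishingIdeal_singleton [IsAlgClosed K] [Finite σ] (α : σ → K) :
    ((vanishingIdeal K {α}).height : WithBot ℕ∞) = ringKrullDim (MvPolynomial σ K) := by
  apply le_antisymm
  · exact Ideal.height_le_ringKrullDim_of_ne_top Ideal.IsPrime.ne_top'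
  · rw [ringKrullDim_le_iff_isMaximal_height_le]
    intro M hM
    obtain ⟨β, rfl⟩ := isMaximal_iff_eq_vanishingIdeal_singleton.1 hM
    have := RingEquiv.height_comap (translateEquiv (α - β)).toRingEquiv (vanishingIdeal K {β})
    rw [comap_translateEquiv, add_sub_cancel] at this
    rw [this]

theorem ringKrullDim_quotient_span_singleton [IsAlgClosed K] [Fintype σ] {F : MvPolynomial σ K}
    (hF : F ≠ 0) {α : σ → K} (hα : eval α F = 0) :
    ringKrullDim (MvPolynomial σ K ⧸ Ideal.span {F}) + 1 = Fintype.card σ := by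
  rw [Module.ringKrullDim_quotient_add_one_of_mem_nonZeroDivisors (mem_nonZeroDivisors_of_ne_zero hF)
    (height_vanishingIdeal_singleton α), ringKrullDim_of_isNoetherianRing,
    ringKrullDim_eq_zero_of_field, zero_add, Nat.card_eq_fintype_card]
  rw [mem_vanishingIdeal_singleton_iff]
  simpa only [aeval_eq_eval] using hα

/-- The differential of a polynomial at a point, as a linear functional. -/
noncomputable def differential [Fintype σ] (F : MvPolynomial σ K) (α : σ → K) :
    (σ → K) →ₗ[K] K :=
  ∑ i, eval α (pderiv i F) • LinearMap.proj i

theorem differential_apply [Fintype σ] (F : MvPolynomial σ K) (α v : σ → K) :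
    differential F α v = ∑ i, eval α (pderiv i F) * v i := by
  simp [differential]

theorem tangentSpace_eq_ker [Fintype σ] {V : Set (σ → K)} {F : MvPolynomial σ K} {α : σ → K}
    (hV : vanishingIdeal K V = Ideal.span {F}) (hα : eval α F = 0) :
    tangentSpace V α = LinearMap.ker (differential F α) := by
  ext v
  rw [LinearMap.mem_ker, differential_apply]
  constructor
  · intro h
    exact h F (hV ▸ Ideal.mem_span_singleton_self F)
  · intro h f hf
    rw [hV] at hf
    obtain ⟨k, rfl⟩ := Ideal.mem_span_singleton.1 hf
    simp only [Derivation.leibniz, smul_eq_mul, map_add, map_mul, hα, zero_mul, zero_add,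
      mul_assoc]
    rw [← Finset.mul_sum, h, mul_zero]

/-- The tangent space is the kernel of one linear functional, and V has codimension 1; the
dimensions differ exactly when that functional is zero. -/
theorem isSingularPoint_iff_differential_eq_zero [IsAlgClosed K] [Fintype σ] [Nonempty σ] {V : Set (σ → K)}
    {F : MvPolynomial σ K} (hF : F ≠ 0) (hV : vanishingIdeal K V = Ideal.span {F}) {α : σ → K}
    (hα : α ∈ V) : IsSingularPoint V α ↔ differential F α = 0 := by
  have h0 : eval α F = 0 := by
    have : F ∈ vanishingIdeal K V := hV ▸ Ideal.mem_span_singleton_self F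
    simpa only [aeval_eq_eval] using mem_vanishingIdeal_iff.1 this α hα
  have hdim := ringKrullDim_quotient_span_singleton hF h0
  obtain ⟨N, hN⟩ := Nat.exists_eq_succ_of_ne_zero (Fintype.card_ne_zero (α := σ))
  have hdim : ringKrullDim (MvPolynomial σ K ⧸ Ideal.span {F}) = N := by
    have h := ringKrullDim_quotient_span_singleton hF h0
    rw [hN, Nat.succ_eq_add_one, Nat.cast_add, Nat.cast_one] at h
    exact ENat.WithBot.add_one_cancel.1 h
  rw [IsSingularPoint, tangentSpace_eq_ker hV h0, hV, hdim, Nat.cast_lt]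
  by_cases hd : differential F α = 0
  · have h1 : Module.finrank K (LinearMap.ker (differential F α)) = N + 1 := by
      rw [hd, LinearMap.ker_zero, finrank_top, Module.finrank_fintype_fun_eq_card, hN]
    rw [h1]
    simp [hd, hα]
  · have h1 := Module.Dual.finrank_ker_add_one_of_ne_zero (f := differential F α) hd
    rw [Module.finrank_fintype_fun_eq_card, hN] at h1
    rw [Nat.succ_injective h1]
    simp [hd]

end PolynomialDimension

/-! ### Singular points of the hypersurface -/

section Singular

variable {K : Type*} [Field K] {m p q : ℕ} {a : Fin m → ℕ} {b : Fin p → ℕ} {c : Fin q → ℕ}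

theorem eval_pderiv_eq_zero_of_sq_dvd {σ : Type*} {f : MvPolynomial σ K} {l : σ} {α : σ → K}
    (hf : X l ^ 2 ∣ f) (hl : α l = 0) (i : σ) : eval α (pderiv i f) = 0 := by
  obtain ⟨g, rfl⟩ := hf
  simp [Derivation.leibniz, Derivation.leibniz_pow, hl]

theorem sq_dvd_prod_X_pow {σ : Type*} {n : ℕ} {e : Fin n → ℕ} (he : ∀ i, 2 ≤ e i)
    (f : Fin n → σ) (i : Fin n) : (X (f i) ^ 2 : MvPolynomial σ K) ∣ ∏ i, X (f i) ^ e i :=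
  (pow_dvd_pow _ (he i)).trans (Finset.dvd_prod_of_mem _ (Finset.mem_univ i))

variable [IsAlgClosed K] [CharZero K] (hp : 1 ≤ p)
  (ha : ∀ i, 2 ≤ a i) (hb : ∀ j, 2 ≤ b j) (hc : ∀ k, 2 ≤ c k)

include hp ha hb hc

/-- The derivative by x gives Y = 0, the one by a z-variable gives Z = 0, and then S = 0 by the
equation. Conversely, exponents at least 2 make each monomial vanish to second order. -/
theorem isSingularPoint_hypersurface_iff {α : Coord m p q → K} :
    IsSingularPoint (hypersurface K a b c) α ↔ α ∈ hypersurface K a b c ∧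
      (∃ l, α (yIdx l) = 0) ∧ (∃ j, α (zIdx j) = 0) ∧ ∃ k, α (sIdx k) = 0 := by
  classical
  by_cases hα : α ∈ hypersurface K a b c
  swap
  · exact ⟨fun h => (hα h.1).elim, fun h => (hα h.1).elim⟩
  rw [isSingularPoint_iff_differential_eq_zero (irreducible_trinomial K a b c).ne_zero
    (vanishingIdeal_hypersurface K a b c) hα]
  constructor
  · intro h
    have hd : ∀ i, eval α (pderiv i (trinomial K a b c)) = 0 := by
      intro i
      have := LinearMap.congr_fun h (Pi.single i 1)
      rw [differential_apply] at this
      simpa [Pi.single_apply] using this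
    have hvars : ∀ {n : ℕ} (e : Fin n → ℕ) (f : Fin n → Coord m p q) (i : Coord m p q),
        (∀ l, f l ≠ i) → pderiv i (∏ l, X (f l) ^ e l : MvPolynomial (Coord m p q) K) = 0 := by
      intro n e f i hf
      refine pderiv_eq_zero_of_notMem_vars fun h => ?_
      obtain ⟨l, -, h⟩ := Finset.mem_biUnion.1 (vars_prod _ h)
      have := vars_pow _ _ h
      rw [vars_X, Finset.mem_singleton] at this
      exact hf l this.symm
    have hy : ∏ i, α (yIdx i) ^ a i = 0 := by
      have := hd xIdx
      rw [trinomial, map_add, map_add, map_add, map_add, hvars b zIdx _ (by simp), hvars c sIdx _ (by simp),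
        Derivation.leibniz, hvars a yIdx _ (by simp), pderiv_X_self] at this
      simpa using this
    have hz : ∏ j, α (zIdx j) ^ b j = 0 := by
      have h1 := hd (zIdx ⟨0, hp⟩)
      have h2 := eval_pderiv_prod_X_pow (K := K) (f := (zIdx : Fin p → Coord m p q))
        (fun i j h => by simpa using h) b ⟨0, hp⟩ α
      rw [trinomial, map_add, map_add, map_add, hvars c sIdx _ (by simp),
        Derivation.leibniz, hvars a yIdx _ (by simp), pderiv_X_of_ne (by simp)] at h1
      simp only [smul_zero, zero_add, add_zero, map_zero] at h1
      rw [h1, mul_zero] at h2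
      have hb0 : (b ⟨0, hp⟩ : K) ≠ 0 := Nat.cast_ne_zero.2 (by have := hb ⟨0, hp⟩; omega)
      exact (mul_eq_zero.1 h2.symm).resolve_left hb0
    have hs : ∏ k, α (sIdx k) ^ c k = 0 := by
      rw [mem_hypersurface, hy, hz] at hα
      simpa using hα
    obtain ⟨l, -, hl⟩ := Finset.prod_eq_zero_iff.1 hy
    obtain ⟨j, -, hj⟩ := Finset.prod_eq_zero_iff.1 hz
    obtain ⟨k, -, hk⟩ := Finset.prod_eq_zero_iff.1 hs
    exact ⟨hα, ⟨l, eq_zero_of_pow_eq_zero hl⟩,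
      ⟨j, eq_zero_of_pow_eq_zero hj⟩,
      ⟨k, eq_zero_of_pow_eq_zero hk⟩⟩
  · rintro ⟨-, ⟨l, hl⟩, ⟨j, hj⟩, ⟨k, hk⟩⟩
    refine LinearMap.ext fun v => ?_
    rw [differential_apply, LinearMap.zero_apply]
    refine Finset.sum_eq_zero fun i _ => ?_
    rw [trinomial, map_add, map_add, map_add, map_add,
      eval_pderiv_eq_zero_of_sq_dvd ((sq_dvd_prod_X_pow ha yIdx l).mul_left _) hl,
      eval_pderiv_eq_zero_of_sq_dvd (sq_dvd_prod_X_pow hb zIdx j) hj,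
      eval_pderiv_eq_zero_of_sq_dvd (sq_dvd_prod_X_pow hc sIdx k) hk]
    ring

end Singular

/-! ### The orbits as affine spaces -/

section Isomorphisms

variable {K : Type*} [Field K] {m p q : ℕ} {a : Fin m → ℕ} {b : Fin p → ℕ} {c : Fin q → ℕ}

/-- On this fibre Y is a nonzero constant, so the equation gives x as a polynomial in the free
coordinates z, s. -/
theorem areIsomorphic_fibreS {d : Fin m → K} (hd : ∀ i, d i ≠ 0) :
    AreIsomorphic (fibreS a b c d) (Set.univ : Set (Fin (p + q) → K)) := by
  have hY : ∏ i, d i ^ a i ≠ 0 := Finset.prod_ne_zero_iff.2 fun i _ => pow_ne_zero _ (hd i)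
  let point (u : Fin (p + q) → K) : Coord m p q → K :=
    Sum.elim (fun _ => -(∏ i, d i ^ a i)⁻¹ * eval (u ∘ finSumFinEquiv) (tailPoly K b c))
      (Sum.elim d (u ∘ finSumFinEquiv))
  have hpoint : ∀ u, point u ∈ fibreS a b c d := by
    intro u
    refine ⟨mem_hypersurface_iff_tail.2 ?_, fun i => rfl⟩
    have h1 : yProd a (point u) = ∏ i, d i ^ a i := rfl
    have h2 : tail (point u) = u ∘ finSumFinEquiv := rfl
    rw [h1, h2]
    simp only [point, Sum.elim_inl]
    field_simp
    ring
  refine ⟨⟨fun α => ⟨fun w => α.1 (Sum.inr (Sum.inr (finSumFinEquiv.symm w))), trivial⟩,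
    fun u => ⟨point u.1, hpoint u.1⟩, ?_, ?_⟩, ?_, ?_⟩
  · rintro ⟨α, hα, hαd⟩
    have h2 : (fun w => α (Sum.inr (Sum.inr (finSumFinEquiv.symm w)))) ∘ finSumFinEquiv =
        tail α := by
      funext w
      simp [tail]
    apply Subtype.ext
    funext w
    rcases w with ⟨⟩ | i | w
    · have h1 := mem_hypersurface_iff_tail.1 hα
      simp only [yProd, hαd] at h1
      simp only [point, Sum.elim_inl, h2]
      rw [eq_neg_of_add_eq_zero_right h1]
      field_simp
    · exact (hαd i).symm
    · exact congrFun h2 w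
  · rintro ⟨u, -⟩
    apply Subtype.ext
    funext w
    simp [point]
  · exact ⟨fun w => X (Sum.inr (Sum.inr (finSumFinEquiv.symm w))), fun v w => by simp⟩
  · refine ⟨Sum.elim (fun _ => C (-(∏ i, d i ^ a i)⁻¹) * rename finSumFinEquiv (tailPoly K b c))
      (Sum.elim (fun i => C (d i)) fun w => X (finSumFinEquiv w)), fun u w => ?_⟩
    rcases w with ⟨⟩ | i | w
    · simp [point, eval_rename]
    · simp [point]
    · simp [point]

theorem areIsomorphic_fibreL (ha : ∀ i, a i ≠ 0) {d : Fin m → K} {r : Fin p → K} {t : Fin q → K}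
    (h : IsLineParam b c d r t) :
    AreIsomorphic (fibreL a b c d r t) (Set.univ : Set (Fin 1 → K)) := by
  obtain ⟨⟨l, hl⟩, -, -, hrt⟩ := h
  have hY : ∏ i, d i ^ a i = 0 :=
    Finset.prod_eq_zero (Finset.mem_univ l) (by rw [hl, zero_pow (ha l)])
  have hpoint : ∀ x : K, mkPoint x d r t ∈ fibreL a b c d r t := by
    intro x
    refine ⟨(mem_hypersurface K a b c).2 ?_, fun _ => rfl, fun _ => rfl, fun _ => rfl⟩
    simp [mkPoint, hY, hrt]
  refine ⟨⟨fun α => ⟨fun _ => α.1 xIdx, trivial⟩,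
    fun u => ⟨mkPoint (u.1 0) d r t, hpoint _⟩, ?_, ?_⟩, ?_, ?_⟩
  · rintro ⟨α, -, hd, hr, ht⟩
    apply Subtype.ext
    funext w
    rcases w with ⟨⟩ | i | j | k
    · rfl
    · exact (hd i).symm
    · exact (hr j).symm
    · exact (ht k).symm
  · rintro ⟨u, -⟩
    apply Subtype.ext
    funext w
    rw [Subsingleton.elim w 0]
    rfl
  · exact ⟨fun _ => X xIdx, fun v w => by simp⟩
  · refine ⟨mkPoint (X 0) (fun i => C (d i)) (fun j => C (r j)) fun k => C (t k), fun u w => ?_⟩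
    rcases w with ⟨⟩ | i | j | k <;> simp [mkPoint]

end Isomorphisms

/-! ### Determination of the orbits -/

section Orbits

variable {K : Type*} [Field K] [IsAlgClosed K] [CharZero K] {m p q : ℕ} {a : Fin m → ℕ}
  {b : Fin p → ℕ} {c : Fin q → ℕ} (hp : 1 ≤ p)
  (ha : ∀ i, 2 ≤ a i) (hb : ∀ j, 2 ≤ b j) (hc : ∀ k, 2 ≤ c k)
  (hH : ¬ (((∀ j, Even (b j)) ∧ ∃ j, b j = 2) ∧ ((∀ k, Even (c k)) ∧ ∃ k, c k = 2)))

omit [IsAlgClosed K] [CharZero K] in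
theorem mem_image_orbit_iff {σ : Type*} {V : Set (σ → K)} {α : V} {β : σ → K} :
    β ∈ Subtype.val '' MulAction.orbit (SAut V) α ↔ ∃ g ∈ SAut V, (g α : σ → K) = β := by
  constructor
  · rintro ⟨_, ⟨g, rfl⟩, rfl⟩
    exact ⟨g.1, g.2, rfl⟩
  · rintro ⟨g, hg, rfl⟩
    exact ⟨_, ⟨⟨g, hg⟩, rfl⟩, rfl⟩

include hp ha hb hc hH

theorem orbit_eq_fibreS {α : hypersurface K a b c}
    (h0 : ∀ i, (α : Coord m p q → K) (yIdx i) ≠ 0) :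
    Subtype.val '' MulAction.orbit (SAut (hypersurface K a b c)) α =
      fibreS a b c fun i => (α : Coord m p q → K) (yIdx i) := by
  ext β
  rw [mem_image_orbit_iff]
  constructor
  · rintro ⟨g, hg, rfl⟩
    exact ⟨(g α).2, (isSautInvariant_of_mem_SAut hp ha hb hc hH hg α).1⟩
  · rintro ⟨hβ, h⟩
    obtain ⟨g, hg, hgα⟩ := exists_mem_SAut_of_y_eq (β := ⟨β, hβ⟩) h0 h
    exact ⟨g, hg, congrArg Subtype.val hgα⟩

theorem orbit_eq_fibreL {α : hypersurface K a b c}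
    (h0 : ∃ l, (α : Coord m p q → K) (yIdx l) = 0)
    (hz : ∀ j, (α : Coord m p q → K) (zIdx j) ≠ 0) :
    Subtype.val '' MulAction.orbit (SAut (hypersurface K a b c)) α =
      fibreL a b c (fun i => (α : Coord m p q → K) (yIdx i))
        (fun j => (α : Coord m p q → K) (zIdx j)) fun k => (α : Coord m p q → K) (sIdx k) := by
  ext β
  rw [mem_image_orbit_iff]
  constructor
  · rintro ⟨g, hg, rfl⟩
    obtain ⟨h1, h2⟩ := isSautInvariant_of_mem_SAut hp ha hb hc hH hg α
    exact ⟨(g α).2, h1, (h2 h0).1, (h2 h0).2.1⟩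
  · rintro ⟨hβ, hy, hz', hs⟩
    obtain ⟨l, hl⟩ := h0
    have hY : yProd a (α : Coord m p q → K) = 0 := Finset.prod_eq_zero (Finset.mem_univ l)
      (by rw [hl, zero_pow (by have := ha l; omega)])
    obtain ⟨g, hg, hgα⟩ := exists_mem_SAut_of_tail_eq (β := ⟨β, hβ⟩) hp
      (fun j => by have := hb j; omega) hY hz (by
        rintro (i | j | k)
        exacts [hy i, hz' j, hs k])
    exact ⟨g, hg, congrArg Subtype.val hgα⟩

theorem apply_eq_of_isSingularPoint {α : hypersurface K a b c}
    (hα : IsSingularPoint (hypersurface K a b c) (α : Coord m p q → K))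
    {g : Equiv.Perm (hypersurface K a b c)} (hg : g ∈ SAut (hypersurface K a b c)) :
    g α = α := by
  obtain ⟨-, hy, hz, hs⟩ := (isSingularPoint_hypersurface_iff hp ha hb hc).1 hα
  exact ((isSautInvariant_of_mem_SAut hp ha hb hc hH hg α).2 hy).2.2 hz hs

theorem orbit_eq_singleton {α : hypersurface K a b c}
    (hα : IsSingularPoint (hypersurface K a b c) (α : Coord m p q → K)) :
    Subtype.val '' MulAction.orbit (SAut (hypersurface K a b c)) α =
      {(α : Coord m p q → K)} := by
  ext β
  rw [mem_image_orbit_iff, Set.mem_singleton_iff]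
  constructor
  · rintro ⟨g, hg, rfl⟩
    rw [apply_eq_of_isSingularPoint hp ha hb hc hH hα hg]
  · rintro rfl
    exact ⟨1, one_mem _, rfl⟩

theorem sautOrbits_hypersurface : sautOrbits (hypersurface K a b c) =
    {O | ∃ d : Fin m → K, (∀ i, d i ≠ 0) ∧ O = fibreS a b c d} ∪
    {O | ∃ (d : Fin m → K) (r : Fin p → K) (t : Fin q → K),
      IsLineParam b c d r t ∧ O = fibreL a b c d r t} ∪
    {O | ∃ α : Coord m p q → K, IsSingularPoint (hypersurface K a b c) α ∧ O = {α}} := by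
  ext O
  constructor
  · rintro ⟨α, rfl⟩
    by_cases hy : ∀ i, (α : Coord m p q → K) (yIdx i) ≠ 0
    · exact Or.inl (Or.inl ⟨_, hy, orbit_eq_fibreS hp ha hb hc hH hy⟩)
    push Not at hy
    obtain ⟨l, hl⟩ := hy
    have hY : ∏ i, (α : Coord m p q → K) (yIdx i) ^ a i = 0 :=
      Finset.prod_eq_zero (Finset.mem_univ l) (by rw [hl, zero_pow (by have := ha l; omega)])
    have hrel := (mem_hypersurface K a b c).1 α.2
    rw [hY, mul_zero, zero_add] at hrel
    -- With Y = 0 the equation reads Z = -S, so either no z_j and no s_k vanishes, or one of each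
    -- does and the point is singular.
    by_cases hz : ∀ j, (α : Coord m p q → K) (zIdx j) ≠ 0
    · refine Or.inl (Or.inr ⟨_, _, _, ⟨⟨l, hl⟩, hz, fun k hk => ?_,
        eq_neg_of_add_eq_zero_left hrel⟩, orbit_eq_fibreL hp ha hb hc hH ⟨l, hl⟩ hz⟩)
      rw [Finset.prod_eq_zero (i := k) (Finset.mem_univ k)
        (by rw [hk, zero_pow (by have := hc k; omega)]), add_zero] at hrel
      exact Finset.prod_ne_zero_iff.2 (fun j _ => pow_ne_zero _ (hz j)) hrel
    · push Not at hz
      obtain ⟨j, hj⟩ := hz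
      rw [Finset.prod_eq_zero (i := j) (Finset.mem_univ j)
        (by rw [hj, zero_pow (by have := hb j; omega)]), zero_add] at hrel
      obtain ⟨k, -, hk⟩ := Finset.prod_eq_zero_iff.1 hrel
      have hα := (isSingularPoint_hypersurface_iff hp ha hb hc).2
        ⟨α.2, ⟨l, hl⟩, ⟨j, hj⟩, ⟨k, eq_zero_of_pow_eq_zero hk⟩⟩
      exact Or.inr ⟨_, hα, orbit_eq_singleton hp ha hb hc hH hα⟩
  · rintro ((⟨d, hd, rfl⟩ | ⟨d, r, t, h, rfl⟩) | ⟨α, hα, rfl⟩)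
    -- The isomorphism with affine space serves here only to provide a point of the fibre.
    · obtain ⟨e, -⟩ := areIsomorphic_fibreS (a := a) (b := b) (c := c) hd
      obtain ⟨α, hα, hαd⟩ := e.symm ⟨0, trivial⟩
      obtain rfl : (fun i => α (yIdx i)) = d := funext hαd
      exact ⟨⟨α, hα⟩, (orbit_eq_fibreS hp ha hb hc hH (α := ⟨α, hα⟩) hd).symm⟩
    · obtain ⟨e, -⟩ := areIsomorphic_fibreL (a := a) (fun i => by have := ha i; omega) h
      obtain ⟨α, hα, hd, hr, ht⟩ := e.symm ⟨0, trivial⟩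
      obtain rfl : (fun i => α (yIdx i)) = d := funext hd
      obtain rfl : (fun j => α (zIdx j)) = r := funext hr
      obtain rfl : (fun k => α (sIdx k)) = t := funext ht
      exact ⟨⟨α, hα⟩, (orbit_eq_fibreL hp ha hb hc hH (α := ⟨α, hα⟩) h.1 h.2.1).symm⟩
    · exact ⟨⟨α, hα.1⟩, (orbit_eq_singleton hp ha hb hc hH (α := ⟨α, hα.1⟩) hα).symm⟩

end Orbits

end TrinomialOrbits

theorem mainTheorem9 {K : Type*} [Field K] [IsAlgClosed K] [CharZero K]
    {m p q : ℕ} (hm : 1 ≤ m) (hp : 1 ≤ p)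
    (a : Fin m → ℕ) (b : Fin p → ℕ) (c : Fin q → ℕ)
    (ha : ∀ i, 2 ≤ a i) (hb : ∀ j, 2 ≤ b j) (hc : ∀ k, 2 ≤ c k)
    (hH4 : ¬ (((∀ j, Even (b j)) ∧ ∃ j, b j = 2) ∧ ((∀ k, Even (c k)) ∧ ∃ k, c k = 2))) :
    TrinomialOrbits.sautOrbits (TrinomialOrbits.hypersurface K a b c) =
        {O | ∃ d : Fin m → K, (∀ i, d i ≠ 0) ∧ O = TrinomialOrbits.fibreS a b c d} ∪
        {O | ∃ (d : Fin m → K) (r : Fin p → K) (t : Fin q → K),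
          TrinomialOrbits.IsLineParam b c d r t ∧ O = TrinomialOrbits.fibreL a b c d r t} ∪
        {O | ∃ α : TrinomialOrbits.Coord m p q → K,
          TrinomialOrbits.IsSingularPoint (TrinomialOrbits.hypersurface K a b c) α ∧ O = {α}} ∧
    (∀ d : Fin m → K, (∀ i, d i ≠ 0) →
      TrinomialOrbits.AreIsomorphic (TrinomialOrbits.fibreS a b c d)
        (Set.univ : Set (Fin (p + q) → K))) ∧
    (∀ (d : Fin m → K) (r : Fin p → K) (t : Fin q → K),
      TrinomialOrbits.IsLineParam b c d r t →
      TrinomialOrbits.AreIsomorphic (TrinomialOrbits.fibreL a b c d r t)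
        (Set.univ : Set (Fin 1 → K))) ∧
    (∀ α : TrinomialOrbits.hypersurface K a b c,
      TrinomialOrbits.IsSingularPoint (TrinomialOrbits.hypersurface K a b c)
        (α : TrinomialOrbits.Coord m p q → K) →
      ∀ g ∈ TrinomialOrbits.SAut (TrinomialOrbits.hypersurface K a b c), g α = α) := by
  refine ⟨TrinomialOrbits.sautOrbits_hypersurface hp ha hb hc hH4,
    fun d hd => TrinomialOrbits.areIsomorphic_fibreS hd,
    fun d r t h => TrinomialOrbits.areIsomorphic_fibreL (fun i => ?_) h,
    fun α hα g hg => TrinomialOrbits.apply_eq_of_isSingularPoint hp ha hb hc hH4 hα hg⟩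
  have := ha i
  omega
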